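/- Let $\mathcal P=\mathbb C[z]$ with algebraic dual $\mathcal P^*$, and for $\mathbf u\in\mathcal P^*$, $g\in\mathcal P$ put $\langle g\mathbf u,f\rangle:=\langle\mathbf u,fg\rangle$. A sequence $(P_n)_{n\ge0}$ in $\mathcal P$ with $\deg P_n=n$ is an OPS with respect to $\mathbf u$ if $\langle\mathbf u,P_nP_k\rangle=h_n\delta_{n,k}$ with all $h_n\ne0$; $\mathbf u$ is regular if it has an OPS. Let $x(s)=\mathfrak c_4s^2+\mathfrak c_5s+\mathfrak c_6$ with $\mathfrak c_4,\mathfrak c_5,\mathfrak c_6\in\mathbb C$. The operators $\mathrm D_x,\mathrm S_x$ on $\mathcal P$ are given by $$\mathrm D_xf(x(s))=\frac{f(x(s+\frac12))-f(x(s-\frac12))}{x(s+\frac12)-x(s-\frac12)},\qquad \mathrm S_xf(x(s))=\frac{f(x(s+\frac12))+f(x(s-\frac12))}{2},$$ and by $\mathrm D_xf=f'$, $\mathrm S_xf=f$ if the lattice is constant ($\mathfrak c_4=\mathfrak c_5=0$). On $\mathcal P^*$ put $\langle\mathbf D_x\mathbf u,f\rangle:=-\langle\mathbf u,\mathrm D_xf\rangle$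 and $\langle\mathbf S_x\mathbf u,f\rangle:=\langle\mathbf u,\mathrm S_xf\rangle$. Put $\beta:=\mathfrak c_4/4$, $\mathtt U_1(z):=2\beta$, $\mathtt U_2(z):=4\beta(z-\mathfrak c_6)+\mathfrak c_5^2/4$. For $\phi,\psi\in\mathcal P$ and $\mathbf u\in\mathcal P^*$ define $\phi^{[0]}:=\phi$, $\psi^{[0]}:=\psi$, $\mathbf u^{[0]}:=\mathbf u$ and, for $k\ge0$, $$\phi^{[k+1]}:=\mathrm S_x\phi^{[k]}+\mathtt U_1\mathrm S_x\psi^{[k]}+\mathtt U_2\mathrm D_x\psi^{[k]},\quad \psi^{[k+1]}:=\mathrm D_x\phi^{[k]}+\mathrm S_x\psi^{[k]}+\mathtt U_1\mathrm D_x\psi^{[k]},$$ $$\mathbf u^{[k+1]}:=\mathbf D_x\big(\mathtt U_2\psi^{[k]}\mathbf u^{[k]}\big)-\mathbf S_x\big(\phi^{[k]}\mathbf u^{[k]}\big).$$ **Theorem.** (1) Let $\mathbf u\in\mathcal P^*\setminus\{\mathbf 0\}$ and let $\phi(z)=az^2+bz+c$, $\psi(z)=dz+e$ with $(\phi,\psi)\neq(0,0)$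 satisfy $\mathbf D_x(\phi\mathbf u)=\mathbf S_x(\psi\mathbf u)$. Put $d_n:=an+d$ and $e_n:=bn+e+2\beta dn^2$. Then for all $n\ge0$ $$\phi^{[n]}(z)=az^2+(b+6\beta nd_n)z+\phi(\beta n^2)+2\beta n\,\psi(\beta n^2)-\tfrac n4\big(16\beta\mathfrak c_6-\mathfrak c_5^2\big)d_n,$$ and $\mathbf u$ is regular if and only if $$d_n\neq0\quad\text{and}\quad\phi^{[n]}\Big(-\beta n^2-\frac{e_n}{d_{2n}}\Big)\neq0\qquad(n=0,1,2,\ldots).$$ Under these conditions there is exactly one monic OPS $(P_n)_{n\ge0}$ with respect to $\mathbf u$; it satisfies $P_{n+1}(z)=(z-B_n)P_n(z)-C_nP_{n-1}(z)$ $(n\ge0)$, $P_{-1}:=0$, with $$B_n=\frac{n e_{n-1}}{d_{2n-2}}-\frac{(n+1)e_n}{d_{2n}}-2\beta n(n-1),\qquad C_{n+1}=-\frac{(n+1)d_{n-1}}{d_{2n-1}d_{2n+1}}\,\phi^{[n]}\Big(-\beta n^2-\frac{e_n}{d_{2n}}\Big)\qquad(n\ge0),$$ where for $n=0$ the first term of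 $B_0$ is read as $0$ and the quotient $d_{n-1}/d_{2n-1}$ in $C_1$ is read as $1$ (even if $d_{-1}$ or $d_{-2}$ vanishes); and the Rodrigues formula $$P_n\mathbf u=k_n\,\mathbf D_x^n\mathbf u^{[n]},\qquad k_n=(-1)^n\prod_{j=1}^nd_{n+j-2}^{-1}\qquad(n\ge0)$$ holds. (2) (Constant lattice.) Let $\mathbf D$ be given by $\langle\mathbf D\mathbf u,f\rangle:=-\langle\mathbf u,f'\rangle$, and call $\mathbf u$ $\mathrm D$-classical if it has an OPS $(P_n)_{n\ge0}$ such that $(P_{n+1}')_{n\ge0}$ is an OPS with respect to some functional. Then $\mathbf u\in\mathcal P^*\setminus\{\mathbf0\}$ is $\mathrm D$-classical if and only if there are $\phi(z)=az^2+bz+c$ and $\psi(z)=dz+e$ with $\mathbf D(\phi\mathbf u)=\psi\mathbf u$ and, with $d_n:=na+d$ and $e_n:=nb+e$, $$d_n\neq0\quad\text{and}\quad\phi\Big(-\frac{e_n}{d_{2n}}\Big)\neq0\qquad(n=0,1,2,\ldots).$$ For all such $\phi,\psi$, there is exactly one monic OPS $(P_n)_{n\ge0}$ with respect to $\mathbf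 u$; it satisfies the same recurrence relation with $$B_n=\frac{ne_{n-1}}{d_{2n-2}}-\frac{(n+1)e_n}{d_{2n}},\qquad C_{n+1}=-\frac{(n+1)d_{n-1}}{d_{2n-1}d_{2n+1}}\,\phi\Big(-\frac{e_n}{d_{2n}}\Big)\qquad(n\ge0)$$ (same reading for $n=0$), and $P_n\mathbf u=k_n\mathbf D^n(\phi^n\mathbf u)$ with $k_n=\prod_{j=0}^{n-1}d_{n+j-1}^{-1}$ $(n\ge0)$. -/

import Mathlib

open Polynomial

/-! Functionals on the space of complex polynomials and orthogonal polynomial sequences. -/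

/-- The algebraic dual of the space of complex polynomials. -/
abbrev PolyDual : Type := Module.Dual ℂ ℂ[X]

/-- Left multiplication of a functional by a polynomial: `⟨g u, f⟩ = ⟨u, f g⟩`. -/
noncomputable def leftMul (g : ℂ[X]) (u : PolyDual) : PolyDual :=
  u ∘ₗ LinearMap.mulLeft ℂ g

/-- The derivative of a functional: `⟨D u, f⟩ = -⟨u, f'⟩`. -/
noncomputable def dualDeriv (u : PolyDual) : PolyDual :=
  -(u ∘ₗ Polynomial.derivative)

/-- `P` is an orthogonal polynomial sequence with respect to `u`. -/
structure IsOPS (u : PolyDual) (P : ℕ → ℂ[X]) : Prop where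
  degree_eq : ∀ n : ℕ, (P n).degree = (n : WithBot ℕ)
  orthogonal : ∀ n k : ℕ, n ≠ k → u (P n * P k) = 0
  sq_ne_zero : ∀ n : ℕ, u (P n * P n) ≠ 0

/-- `P` is a monic orthogonal polynomial sequence with respect to `u`. -/
structure IsMonicOPS (u : PolyDual) (P : ℕ → ℂ[X]) : Prop extends IsOPS u P where
  monic : ∀ n : ℕ, (P n).Monic

/-- `u` is regular (quasi-definite). -/
def IsRegularFunctional (u : PolyDual) : Prop := ∃ P : ℕ → ℂ[X], IsOPS u P

/-- `u` is `D`-classical in Hahn's sense: `u` has an orthogonal polynomial sequence whose sequence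
of derivatives is again an orthogonal polynomial sequence (with respect to some functional). -/
def IsDClassical (u : PolyDual) : Prop :=
  ∃ P : ℕ → ℂ[X], IsOPS u P ∧
    ∃ v : PolyDual, IsOPS v (fun n => Polynomial.derivative (P (n + 1)))

/-- The data of a lattice `x(s) = c₄ s² + c₅ s + c₆` (the case `q = 1`). -/
structure QuadLattice where
  c₄ : ℂ
  c₅ : ℂ
  c₆ : ℂ

namespace QuadLattice

variable (x : QuadLattice)

/-- The lattice function `x(s)`. -/
def val (s : ℂ) : ℂ := x.c₄ * s ^ 2 + x.c₅ * s + x.c₆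

/-- The constant `β`, characterized by `(x(s + 1/2) + x(s - 1/2)) / 2 = x(s) + β`
(for `q = 1` the constant `α` equals `1`). -/
noncomputable def β : ℂ := x.c₄ / 4

/-- The constant `δ`. -/
noncomputable def δ : ℂ := x.c₅ ^ 2 / 4 - x.c₄ * x.c₆

/-- The polynomial `U₁`, which for `q = 1` is the constant `2β`. -/
noncomputable def U₁ : ℂ[X] := C (2 * x.β)

/-- The polynomial `U₂(z) = 4βz + δ`; it satisfies
`U₂(x(s)) = ((x(s + 1/2) - x(s - 1/2)) / 2)²`. -/
noncomputable def U₂ : ℂ[X] := C (4 * x.β) * X + C x.δ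

/-- Substitution of `z + β + w` for the variable of a polynomial, where `w² = U₂(z)`.
At `z = x(s)`, the values of `z + β + w` for the two choices of the square root `w` are the
points `x(s + 1/2)` and `x(s - 1/2)`. -/
noncomputable def shift : ℂ[X] →ₐ[ℂ] QuadraticAlgebra ℂ[X] x.U₂ 0 :=
  Polynomial.aeval (⟨X + C x.β, 1⟩ : QuadraticAlgebra ℂ[X] x.U₂ 0)

/-- The `x`-derivative on polynomials, `f(z + β + w) = (Sₓ f)(z) + (Dₓ f)(z) w`.
See `eval_D`, `eq_D` and `D_of_constant` for its usual characterization. -/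
noncomputable def D : ℂ[X] →ₗ[ℂ] ℂ[X] :=
  (QuadraticAlgebra.imₗ x.U₂ 0).restrictScalars ℂ ∘ₗ x.shift.toLinearMap

/-- The `x`-average on polynomials, `f(z + β + w) = (Sₓ f)(z) + (Dₓ f)(z) w`.
See `eval_S` and `S_of_constant` for its usual characterization. -/
noncomputable def S : ℂ[X] →ₗ[ℂ] ℂ[X] :=
  (QuadraticAlgebra.reₗ x.U₂ 0).restrictScalars ℂ ∘ₗ x.shift.toLinearMap

/-- The `x`-derivative on functionals: `⟨Dₓ u, f⟩ = -⟨u, Dₓ f⟩`. -/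
noncomputable def dualD (u : PolyDual) : PolyDual := -(u ∘ₗ x.D)

/-- The `x`-average on functionals: `⟨Sₓ u, f⟩ = ⟨u, Sₓ f⟩`. -/
noncomputable def dualS (u : PolyDual) : PolyDual := u ∘ₗ x.S

/-- The pair `(φ^{[k]}, ψ^{[k]})` (with `α = 1`). -/
noncomputable def pairSeq (φ ψ : ℂ[X]) : ℕ → ℂ[X] × ℂ[X]
  | 0 => (φ, ψ)
  | k + 1 =>
    let p := pairSeq φ ψ k
    (x.S p.1 + x.U₁ * x.S p.2 + x.U₂ * x.D p.2, x.D p.1 + x.S p.2 + x.U₁ * x.D p.2)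

/-- The polynomial `φ^{[k]}`. -/
noncomputable def phiSeq (φ ψ : ℂ[X]) (k : ℕ) : ℂ[X] := (x.pairSeq φ ψ k).1

/-- The polynomial `ψ^{[k]}`. -/
noncomputable def psiSeq (φ ψ : ℂ[X]) (k : ℕ) : ℂ[X] := (x.pairSeq φ ψ k).2

/-- The functional `u^{[k]}`. -/
noncomputable def uSeq (φ ψ : ℂ[X]) (u : PolyDual) : ℕ → PolyDual
  | 0 => u
  | k + 1 => x.dualD (leftMul (x.U₂ * x.psiSeq φ ψ k) (uSeq φ ψ u k))
      - x.dualS (leftMul (x.phiSeq φ ψ k) (uSeq φ ψ u k))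

/-! The operators are the usual ones. -/

theorem eval_shift (f : ℂ[X]) (z w : ℂ) (hw : w ^ 2 = x.U₂.eval z) :
    (x.S f).eval z + (x.D f).eval z * w = f.eval (z + x.β + w) := by
  have hS : ∀ g, x.S g = (x.shift g).re := fun _ => rfl
  have hD : ∀ g, x.D g = (x.shift g).im := fun _ => rfl
  have hX : x.shift X = ⟨X + C x.β, 1⟩ := by simp [shift]
  simp only [hS, hD]
  induction f using Polynomial.induction_on with
  | C a =>
    have : x.shift (C a) = algebraMap ℂ _ a := x.shift.commutes a
    rw [this, IsScalarTower.algebraMap_apply ℂ ℂ[X] (QuadraticAlgebra ℂ[X] x.U₂ 0)]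
    simp
  | add p q hp hq =>
    simp only [map_add, QuadraticAlgebra.re_add, QuadraticAlgebra.im_add, eval_add]
    linear_combination hp + hq
  | monomial n a h =>
    have e : (C a * X ^ (n + 1) : ℂ[X]) = C a * X ^ n * X := by ring
    rw [e, map_mul, hX]
    simp only [QuadraticAlgebra.re_mul, QuadraticAlgebra.im_mul, eval_add, eval_mul, eval_X,
      eval_C, mul_one, zero_mul, add_zero] at *
    rw [← h, ← hw]
    ring

theorem eval_S (f : ℂ[X]) (s : ℂ) :
    (x.S f).eval (x.val s) = (f.eval (x.val (s + 1 / 2)) + f.eval (x.val (s - 1 / 2))) / 2 := by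
  have h1 := x.eval_shift f (x.val s) (x.c₄ * s + x.c₅ / 2)
    (by simp [U₂, β, δ, val]; ring)
  have h2 := x.eval_shift f (x.val s) (-(x.c₄ * s + x.c₅ / 2))
    (by simp [U₂, β, δ, val]; ring)
  have e1 : x.val (s + 1 / 2) = x.val s + x.β + (x.c₄ * s + x.c₅ / 2) := by
    simp only [val, β]; ring
  have e2 : x.val (s - 1 / 2) = x.val s + x.β + -(x.c₄ * s + x.c₅ / 2) := by
    simp only [val, β]; ring
  rw [e1, e2, ← h1, ← h2]; ring

theorem eval_D (f : ℂ[X]) (s : ℂ) (hs : x.val (s + 1 / 2) ≠ x.val (s - 1 / 2)) :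
    (x.D f).eval (x.val s) =
      (f.eval (x.val (s + 1 / 2)) - f.eval (x.val (s - 1 / 2))) /
        (x.val (s + 1 / 2) - x.val (s - 1 / 2)) := by
  have h1 := x.eval_shift f (x.val s) (x.c₄ * s + x.c₅ / 2)
    (by simp [U₂, β, δ, val]; ring)
  have h2 := x.eval_shift f (x.val s) (-(x.c₄ * s + x.c₅ / 2))
    (by simp [U₂, β, δ, val]; ring)
  have e1 : x.val (s + 1 / 2) = x.val s + x.β + (x.c₄ * s + x.c₅ / 2) := by
    simp only [val, β]; ring
  have e2 : x.val (s - 1 / 2) = x.val s + x.β + -(x.c₄ * s + x.c₅ / 2) := by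
    simp only [val, β]; ring
  rw [eq_div_iff (sub_ne_zero.2 hs), e1, e2, ← h1, ← h2]; ring

/-- On a non-constant lattice the difference quotients determine `Dₓ f`. -/
theorem eq_D (hx : x.c₄ ≠ 0 ∨ x.c₅ ≠ 0) (f g : ℂ[X])
    (hg : ∀ s : ℂ, x.val (s + 1 / 2) ≠ x.val (s - 1 / 2) →
      g.eval (x.val s) =
        (f.eval (x.val (s + 1 / 2)) - f.eval (x.val (s - 1 / 2))) /
          (x.val (s + 1 / 2) - x.val (s - 1 / 2))) : g = x.D f := by
  let L : ℂ[X] := C x.c₄ * X ^ 2 + C x.c₅ * X + C x.c₆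
  let M : ℂ[X] := C (2 * x.c₄) * X + C x.c₅
  have hM : M ≠ 0 := by
    intro h
    have h0 := congrArg (fun p => coeff p 0) h
    have h1 := congrArg (fun p => coeff p 1) h
    simp [M] at h0 h1
    exact hx.elim (fun k => k h1) (fun k => k h0)
  have key : (g - x.D f).comp L * M = 0 := by
    apply Polynomial.funext
    intro s
    have hL : L.eval s = x.val s := by simp [L, val]
    have hd : x.val (s + 1 / 2) - x.val (s - 1 / 2) = M.eval s := by
      simp only [val, M, eval_add, eval_mul, eval_C, eval_X]; ring
    rw [eval_mul, eval_comp, hL, eval_sub]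
    by_cases h : x.val (s + 1 / 2) = x.val (s - 1 / 2)
    · rw [← hd, h]; simp
    · rw [hg s h, x.eval_D f s h]; simp
  have hc : (g - x.D f).comp L = 0 := (mul_eq_zero.1 key).resolve_right hM
  rcases Polynomial.comp_eq_zero_iff.1 hc with h | ⟨-, h⟩
  · exact sub_eq_zero.1 h
  · exfalso
    have h1 := congrArg (fun p => coeff p 1) h
    have h2 := congrArg (fun p => coeff p 2) h
    simp [L, coeff_X, coeff_C] at h1 h2
    exact hx.elim (fun k => k h2) (fun k => k h1)

theorem shift_of_constant (h₄ : x.c₄ = 0) (h₅ : x.c₅ = 0) (f : ℂ[X]) :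
    x.S f = f ∧ x.D f = derivative f := by
  have hS : ∀ g, x.S g = (x.shift g).re := fun _ => rfl
  have hD : ∀ g, x.D g = (x.shift g).im := fun _ => rfl
  have hX : x.shift X = ⟨X + C x.β, 1⟩ := by simp [shift]
  have hβ : x.β = 0 := by simp [β, h₄]
  have hU : x.U₂ = 0 := by simp [U₂, δ, hβ, h₄, h₅]
  simp only [hS, hD]
  induction f using Polynomial.induction_on with
  | C a =>
    have : x.shift (C a) = algebraMap ℂ _ a := x.shift.commutes a
    rw [this, IsScalarTower.algebraMap_apply ℂ ℂ[X] (QuadraticAlgebra ℂ[X] x.U₂ 0)]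
    simp
  | add p q hp hq =>
    simp only [map_add, QuadraticAlgebra.re_add, QuadraticAlgebra.im_add]
    exact ⟨by rw [hp.1, hq.1], by rw [hp.2, hq.2]⟩
  | monomial n a h =>
    have e : (C a * X ^ (n + 1) : ℂ[X]) = C a * X ^ n * X := by ring
    rw [e, map_mul, hX]
    simp only [QuadraticAlgebra.re_mul, QuadraticAlgebra.im_mul, h.1, h.2, hβ, hU]
    constructor
    · simp
    · rw [derivative_mul (f := C a * X ^ n)]
      simp; ring

theorem S_of_constant (h₄ : x.c₄ = 0) (h₅ : x.c₅ = 0) (f : ℂ[X]) : x.S f = f :=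
  (x.shift_of_constant h₄ h₅ f).1

theorem D_of_constant (h₄ : x.c₄ = 0) (h₅ : x.c₅ = 0) (f : ℂ[X]) : x.D f = derivative f :=
  (x.shift_of_constant h₄ h₅ f).2

end QuadLattice

/-- The coefficients of a pair `φ(z) = a z² + b z + c`, `ψ(z) = d z + e`. -/
structure PearsonPair where
  a : ℂ
  b : ℂ
  c : ℂ
  d : ℂ
  e : ℂ

namespace PearsonPair

variable (p : PearsonPair)

/-- `φ(z) = a z² + b z + c`. -/
noncomputable def φ : ℂ[X] := C p.a * X ^ 2 + C p.b * X + C p.c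

/-- `ψ(z) = d z + e`. -/
noncomputable def ψ : ℂ[X] := C p.d * X + C p.e

/-- `d_n = a n + d`. -/
noncomputable def dn (n : ℤ) : ℂ := p.a * n + p.d

/-- The quotient `d_{n-1} / d_{2n-1}`, read as `1` for `n = 0` (where both indices are `-1`). -/
noncomputable def dRatio (n : ℕ) : ℂ := if n = 0 then 1 else p.dn (n - 1) / p.dn (2 * n - 1)

/-- `k_n = (-1)^n ∏_{j=1}^{n} d_{n+j-2}⁻¹`. -/
noncomputable def rodriguesConst (n : ℕ) : ℂ :=
  (-1) ^ n * ∏ j ∈ Finset.Icc 1 n, (p.dn (n + j - 2))⁻¹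

/-! The constant lattice (ordinary derivative). -/

/-- `e_n = b n + e`. -/
noncomputable def en (n : ℤ) : ℂ := p.b * n + p.e

/-- `B_n = n e_{n-1} / d_{2n-2} - (n+1) e_n / d_{2n}`. -/
noncomputable def recB (n : ℕ) : ℂ :=
  n * p.en (n - 1) / p.dn (2 * n - 2) - (n + 1) * p.en n / p.dn (2 * n)

/-- The coefficient `C_{n+1}`, namely
`-(n+1) d_{n-1} / (d_{2n-1} d_{2n+1}) φ(-e_n / d_{2n})`. -/
noncomputable def recCsucc (n : ℕ) : ℂ :=
  -((n + 1) * p.dRatio n / p.dn (2 * n + 1)) * p.φ.eval (-(p.en n / p.dn (2 * n)))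

/-- `∏_{j=0}^{n-1} d_{n+j-1}⁻¹`, the constant in the formula for the ordinary derivative. -/
noncomputable def derivRodriguesConst (n : ℕ) : ℂ :=
  ∏ j ∈ Finset.range n, (p.dn (n + j - 1))⁻¹

end PearsonPair

namespace QuadLattice

variable (x : QuadLattice) (p : PearsonPair)

/-- `e_n = b n + e + 2 β d n²`. -/
noncomputable def en (n : ℤ) : ℂ := p.b * n + p.e + 2 * x.β * p.d * n ^ 2

/-- The number `φ^{[n]}(-β n² - e_n / d_{2n})`. -/
noncomputable def phiAt (n : ℕ) : ℂ :=
  (x.phiSeq p.φ p.ψ n).eval (-x.β * n ^ 2 - x.en p n / p.dn (2 * n))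

/-- `B_n = n e_{n-1} / d_{2n-2} - (n+1) e_n / d_{2n} - 2 β n (n-1)`. -/
noncomputable def recB (n : ℕ) : ℂ :=
  n * x.en p (n - 1) / p.dn (2 * n - 2) - (n + 1) * x.en p n / p.dn (2 * n)
    - 2 * x.β * n * (n - 1)

/-- The coefficient `C_{n+1}`, namely
`-(n+1) d_{n-1} / (d_{2n-1} d_{2n+1}) φ^{[n]}(-β n² - e_n / d_{2n})`. -/
noncomputable def recCsucc (n : ℕ) : ℂ :=
  -((n + 1) * p.dRatio n / p.dn (2 * n + 1)) * x.phiAt p n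

end QuadLattice

/-- `P_{n+1}(z) = (z - B_n) P_n(z) - C_n P_{n-1}(z)` for all `n ≥ 0`, with `P_{-1} = 0`;
here `Γ n` stands for `C_{n+1}`. -/
def SatisfiesTTRR (P : ℕ → ℂ[X]) (B Γ : ℕ → ℂ) : Prop :=
  P 1 = (X - C (B 0)) * P 0 ∧
    ∀ n : ℕ, P (n + 2) = (X - C (B (n + 1))) * P (n + 1) - C (Γ n) * P n

/-!
Write `w² = U₂` and `E f = Sₓ f + w Dₓ f`, the substitution of `z + β + w` for `z`. Since
`U₂(z + β + w) = (w + 2β)²`, the substitution extends to the quadratic extension of `ℂ[z]` by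
`E w = w + 2β`, and `E (Sₓ g) = (w + 2β) E (Dₓ g) + g` (`QuadLattice.commutation`). With
`Φ = φ + ψ w`, the equation `Dₓ(φ u) = Sₓ(ψ u)` says that `u` annihilates the `w`-component
`φ Dₓ f + ψ Sₓ f` of `Φ E f` for every polynomial `f`, and `⟨u^{[1]}, f⟩` is minus the value of `u`
at the other component. The identity above then yields two facts: `u^{[1]}` satisfies the equation
belonging to `E Φ = φ^{[1]} + ψ^{[1]} w` (`IsPearson.derived`), and
`Dₓ(f u^{[1]}) = -(φ Dₓ f + ψ Sₓ f) u` (`IsPearson.derivedDual_D_mul`). In the latter, a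
polynomial `f` of degree `m` with leading coefficient `1` is sent to one of degree at most `m + 1`
with coefficient `-dₘ`; at level `n` the number `dₘ` becomes `d_{2n+m}`.

Sufficiency and the explicit formulas. By iteration `Dₓⁿ u^{[n]} = Rₙ u` with a polynomial `Rₙ` of
degree `n` whose leading coefficient is `kₙ⁻¹`; put `Pₙ = kₙ Rₙ`. Then
`⟨u, Pₙ f⟩ = kₙ (-1)ⁿ ⟨u^{[n]}, Dₓⁿ f⟩`, which vanishes for `deg f < n`. The operator `Dₓⁿ` is
explicit on degrees `n` and `n + 1`, and the first two moments of `u^{[n]}` come from its Pearson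
equation: its mean is the zero of `ψ^{[n]}`, and
`⟨u^{[n+1]}, 1⟩ = -(d_{2n} / d_{2n+1}) φ^{[n]}(-β n² - eₙ / d_{2n}) ⟨u^{[n]}, 1⟩`. This gives
`⟨u, Pₙ zⁿ⟩` and `⟨u, Pₙ zⁿ⁺¹⟩`, hence orthogonality and both recurrence coefficients
(`QuadLattice.exists_isMonicOPS`).

Necessity. If `u` is regular with orthogonal polynomials `Pₙ` and `dₙ = 0`, then `Dₓ Pₙ₊₁`
annihilates `u^{[1]}`, which forces `φ = ψ = 0` (`IsPearson.dn_ne_zero`). Hence all `dₙ ≠ 0`, the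
polynomials `Dₓ Pₙ₊₁` are orthogonal with respect to `u^{[1]}`, every `u^{[n]}` is regular, and
`⟨u^{[n]}, 1⟩ ≠ 0` together with the formula for `⟨u^{[n+1]}, 1⟩` gives the second condition.

For the constant lattice `u^{[n]} = (-1)ⁿ φⁿ u`, so everything specializes. Orthogonality of the
derivatives is the statement on `Dₓ Pₙ₊₁` above, and conversely Hahn's property yields a
Pearson equation by expanding two functionals in the basis dual to `(Pₙ)`
(`IsDClassical.exists_pearson`).
-/

/-! ### Preliminaries on polynomials and products -/

theorem degree_lt_succ_iff {n : ℕ} {f : ℂ[X]} :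
    f.degree < ((n + 1 : ℕ) : WithBot ℕ) ↔ f.degree ≤ (n : WithBot ℕ) := by
  simp only [degree_lt_iff_coeff_zero, degree_le_iff_coeff_zero, Nat.cast_lt, Nat.succ_le_iff]

theorem map_eq_sum (L : ℂ[X] →ₗ[ℂ] ℂ[X]) {n : ℕ} {f : ℂ[X]} (hf : f.degree < (n : WithBot ℕ)) :
    L f = ∑ i ∈ Finset.range n, C (f.coeff i) * L (X ^ i) := by
  have h : f = ∑ i ∈ Finset.range n, f.coeff i • X ^ i := by
    rw [degree_lt_iff_coeff_zero] at hf
    ext k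
    rw [finsetSum_coeff]
    simp only [coeff_smul, coeff_X_pow, smul_eq_mul, mul_ite, mul_one, mul_zero,
      Finset.sum_ite_eq, Finset.mem_range]
    split_ifs with hk
    · rfl
    · exact hf k (by omega)
  conv_lhs => rw [h]
  rw [map_sum]
  exact Finset.sum_congr rfl fun i _ => by rw [map_smul, smul_eq_C_mul]

theorem prod_Icc_one_eq (f : ℕ → ℂ) (n : ℕ) :
    ∏ j ∈ Finset.Icc 1 n, f j = ∏ i ∈ Finset.range n, f (i + 1) := by
  induction n with
  | zero => simp
  | succ n ih => rw [Finset.prod_Icc_succ_top (by omega), ih, Finset.prod_range_succ]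

/-! ### Orthogonal polynomial sequences -/

/-- A polynomial of degree at most `n` is reduced to degree less than `n` by a multiple of any
polynomial of degree exactly `n`. -/
theorem degree_sub_C_mul_lt {n : ℕ} {f p : ℂ[X]} (hf : f.degree < ((n + 1 : ℕ) : WithBot ℕ))
    (hp : p.degree = (n : WithBot ℕ)) :
    (f - C (f.coeff n / p.coeff n) * p).degree < (n : WithBot ℕ) := by
  have hc : p.coeff n ≠ 0 := coeff_ne_zero_of_eq_degree hp
  rw [degree_lt_iff_coeff_zero] at hf ⊢
  intro m hm
  rcases hm.eq_or_lt with rfl | hm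
  · simp [hc]
  · have h2 : p.coeff m = 0 := coeff_eq_zero_of_degree_lt (by rw [hp]; exact_mod_cast hm)
    simp [hf m hm, h2]

/-- A functional vanishing on the first `n` members of a sequence of polynomials of degrees
`0, 1, 2, …` vanishes on all polynomials of degree less than `n`. -/
theorem dual_eq_zero_of_degree_lt {P : ℕ → ℂ[X]} (hP : ∀ n, (P n).degree = (n : WithBot ℕ))
    (L : PolyDual) (n : ℕ) (hL : ∀ k < n, L (P k) = 0) (f : ℂ[X])
    (hf : f.degree < (n : WithBot ℕ)) : L f = 0 := by
  induction n generalizing f with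
  | zero =>
    have : f = 0 := by simpa using hf
    simp [this]
  | succ n ih =>
    have h := ih (fun k hk => hL k (by omega)) _ (degree_sub_C_mul_lt hf (hP n))
    rwa [map_sub, ← smul_eq_C_mul, map_smul, hL n (by omega), smul_zero, sub_zero] at h

theorem degree_lt_natDegree_succ (f : ℂ[X]) :
    f.degree < ((f.natDegree + 1 : ℕ) : WithBot ℕ) :=
  lt_of_le_of_lt degree_le_natDegree (by exact_mod_cast Nat.lt_succ_self _)

theorem dual_eq_zero {P : ℕ → ℂ[X]} (hP : ∀ n, (P n).degree = (n : WithBot ℕ))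
    (L : PolyDual) (hL : ∀ k, L (P k) = 0) : L = 0 :=
  LinearMap.ext fun f => dual_eq_zero_of_degree_lt hP L _ (fun k _ => hL k) f
    (degree_lt_natDegree_succ f)

@[simp]
theorem leftMul_apply (g : ℂ[X]) (u : PolyDual) (f : ℂ[X]) : leftMul g u f = u (g * f) := rfl

theorem apply_C_mul (u : PolyDual) (c : ℂ) (f : ℂ[X]) : u (C c * f) = c * u f := by
  rw [← smul_eq_C_mul, map_smul, smul_eq_mul]

namespace IsOPS

variable {u : PolyDual} {P : ℕ → ℂ[X]}

theorem coeff_ne_zero (h : IsOPS u P) (n : ℕ) : (P n).coeff n ≠ 0 :=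
  coeff_ne_zero_of_eq_degree (h.degree_eq n)

theorem apply_mul_of_degree_lt (h : IsOPS u P) {n : ℕ} {f : ℂ[X]}
    (hf : f.degree < (n : WithBot ℕ)) : u (P n * f) = 0 :=
  dual_eq_zero_of_degree_lt h.degree_eq (leftMul (P n) u) n
    (fun k hk => h.orthogonal n k (by omega)) f hf

theorem apply_mul (h : IsOPS u P) {n : ℕ} {f : ℂ[X]}
    (hf : f.degree < ((n + 1 : ℕ) : WithBot ℕ)) :
    u (P n * f) = f.coeff n * (u (P n * P n) / (P n).coeff n) := by
  have h1 := h.apply_mul_of_degree_lt (degree_sub_C_mul_lt hf (h.degree_eq n))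
  rw [mul_sub, map_sub, mul_left_comm, apply_C_mul, sub_eq_zero] at h1
  rw [h1]; ring

/-- A regular functional annihilates no nonzero ideal. -/
theorem eq_zero_of_apply_mul (h : IsOPS u P) {N : ℕ} {G : ℂ[X]}
    (hG : G.degree < (N : WithBot ℕ)) (hu : ∀ k < N, u (G * X ^ k) = 0) : G = 0 := by
  by_contra hne
  have hdeg := degree_eq_natDegree hne
  have hlt : G.natDegree < N := by rw [hdeg] at hG; exact_mod_cast hG
  have h1 : u (P G.natDegree * G) = 0 := by
    rw [mul_comm]
    refine dual_eq_zero_of_degree_lt (P := fun k => X ^ k) (fun k => degree_X_pow k)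
      (leftMul G u) N hu _ ?_
    rw [h.degree_eq]; exact_mod_cast hlt
  rw [h.apply_mul (degree_lt_natDegree_succ G)] at h1
  refine mul_ne_zero (leadingCoeff_ne_zero.2 hne)
    (div_ne_zero (h.sq_ne_zero _) (h.coeff_ne_zero _)) h1

theorem apply_one_ne_zero (h : IsOPS u P) : u 1 ≠ 0 := by
  intro h0
  have h1 := h.sq_ne_zero 0
  have h2 : P 0 = C ((P 0).coeff 0) := eq_C_of_degree_eq_zero (by simpa using h.degree_eq 0)
  rw [h2, ← C_mul, ← mul_one (C _), apply_C_mul, h0, mul_zero] at h1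
  exact h1 rfl

end IsOPS

theorem isMonicOPS_of_apply_mul_X_pow {u : PolyDual} {P : ℕ → ℂ[X]}
    (hdeg : ∀ n, (P n).degree = (n : WithBot ℕ)) (hmon : ∀ n, (P n).Monic)
    (h0 : ∀ n, ∀ k < n, u (P n * X ^ k) = 0) (h1 : ∀ n, u (P n * X ^ n) ≠ 0) :
    IsMonicOPS u P := by
  have key : ∀ (n : ℕ) (f : ℂ[X]), f.degree < (n : WithBot ℕ) → u (P n * f) = 0 := fun n f hf =>
    dual_eq_zero_of_degree_lt (P := fun k => X ^ k) (fun k => degree_X_pow k)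
      (leftMul (P n) u) n (h0 n) f hf
  have hlt : ∀ n k, k < n → u (P n * P k) = 0 := fun n k hk =>
    key n _ (by rw [hdeg]; exact_mod_cast hk)
  refine ⟨⟨hdeg, fun n k hnk => ?_, fun n => ?_⟩, hmon⟩
  · rcases lt_or_gt_of_ne hnk with h | h
    · rw [mul_comm]; exact hlt k n h
    · exact hlt n k h
  · have h2 : (P n - X ^ n).degree < (n : WithBot ℕ) := by
      rw [← hdeg n]
      exact degree_sub_lt_left (by rw [hdeg, degree_X_pow]) (hmon n).ne_zero
        (by rw [(hmon n).leadingCoeff, leadingCoeff_X_pow])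
    have h3 := key n _ h2
    rw [mul_sub, map_sub, sub_eq_zero] at h3
    rw [h3]; exact h1 n

namespace IsMonicOPS

variable {u : PolyDual} {P : ℕ → ℂ[X]}

theorem unique (h : IsMonicOPS u P) {Q : ℕ → ℂ[X]} (hQ : IsMonicOPS u Q) : Q = P := by
  funext n
  rw [← sub_eq_zero]
  have hd : (Q n - P n).degree < (n : WithBot ℕ) := by
    rw [← hQ.degree_eq n]
    exact degree_sub_lt_left (by rw [hQ.degree_eq, h.degree_eq]) (hQ.monic n).ne_zero
      (by rw [(hQ.monic n).leadingCoeff, (h.monic n).leadingCoeff])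
  refine h.eq_zero_of_apply_mul hd fun k hk => ?_
  have hX : (X ^ k : ℂ[X]).degree < (n : WithBot ℕ) := by
    rw [degree_X_pow]; exact_mod_cast hk
  rw [sub_mul, map_sub, h.apply_mul_of_degree_lt hX, hQ.apply_mul_of_degree_lt hX, sub_zero]

/-- The recurrence coefficients are read off from the values of `u` on `Pₙ zⁿ` and `Pₙ zⁿ⁺¹`. -/
theorem satisfiesTTRR (hP : IsMonicOPS u P) {B Γ h t : ℕ → ℂ}
    (hh : ∀ n, u (P n * X ^ n) = h n) (ht : ∀ n, u (P n * X ^ (n + 1)) = t n * h n)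
    (hΓ : ∀ n, h (n + 1) = Γ n * h n) (hB0 : B 0 = t 0)
    (hB : ∀ n, B (n + 1) = t (n + 1) - t n) : SatisfiesTTRR P B Γ := by
  have hzero : ∀ n k, k < n → u (P n * X ^ k) = 0 := fun n k hk =>
    hP.apply_mul_of_degree_lt (by rw [degree_X_pow]; exact_mod_cast hk)
  have hlt : ∀ n k, k < n → (P k).degree < (n : WithBot ℕ) := fun n k hk => by
    rw [hP.degree_eq]; exact_mod_cast hk
  have hsub : ∀ n, (X * P n - P (n + 1)).degree < ((n + 1 : ℕ) : WithBot ℕ) := fun n => by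
    have hd : (X * P n).degree = ((n + 1 : ℕ) : WithBot ℕ) := by
      rw [degree_mul, degree_X, hP.degree_eq, add_comm]; rfl
    have hm : (X * P n).Monic := monic_X.mul (hP.monic n)
    rw [← hd]
    exact degree_sub_lt_left (by rw [hd, hP.degree_eq]) hm.ne_zero
      (by rw [hm.leadingCoeff, (hP.monic _).leadingCoeff])
  have hC : ∀ (c : ℂ) (f : ℂ[X]) (n : ℕ), f.degree < (n : WithBot ℕ) →
      (C c * f).degree < (n : WithBot ℕ) := fun c f n hf => by
    rw [← smul_eq_C_mul]; exact lt_of_le_of_lt (degree_smul_le c f) hf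
  constructor
  · have hG : X * P 0 - P 1 - C (B 0) * P 0 = 0 := by
      refine hP.eq_zero_of_apply_mul (N := 1) ?_ fun k hk => ?_
      · exact lt_of_le_of_lt (degree_sub_le _ _) (max_lt (hsub 0) (hC _ _ _ (hlt _ _ (by omega))))
      · obtain rfl : k = 0 := by omega
        have e : (X * P 0 - P 1 - C (B 0) * P 0) * X ^ 0
            = P 0 * X ^ (0 + 1) - P 1 * X ^ 0 - C (B 0) * (P 0 * X ^ 0) := by ring
        rw [e, map_sub, map_sub, apply_C_mul, ht, hh, hzero 1 0 (by omega), hB0]; ring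
    linear_combination -hG
  · intro n
    have hG : X * P (n + 1) - P (n + 2) - C (B (n + 1)) * P (n + 1) - C (Γ n) * P n = 0 := by
      refine hP.eq_zero_of_apply_mul (N := n + 2) ?_ fun k hk => ?_
      · refine lt_of_le_of_lt (degree_sub_le _ _) (max_lt ?_ (hC _ _ _ (hlt _ _ (by omega))))
        exact lt_of_le_of_lt (degree_sub_le _ _)
          (max_lt (hsub (n + 1)) (hC _ _ _ (hlt _ _ (by omega))))
      · have e : (X * P (n + 1) - P (n + 2) - C (B (n + 1)) * P (n + 1) - C (Γ n) * P n) * X ^ k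
            = P (n + 1) * X ^ (k + 1) - P (n + 2) * X ^ k - C (B (n + 1)) * (P (n + 1) * X ^ k)
              - C (Γ n) * (P n * X ^ k) := by ring
        rw [e, map_sub, map_sub, map_sub, apply_C_mul, apply_C_mul, hzero (n + 2) k hk]
        rcases lt_trichotomy k n with h' | rfl | h'
        · rw [hzero _ _ (by omega), hzero _ _ (by omega), hzero n k h']; ring
        · rw [hzero (k + 1) k (by omega), hh, hh, hΓ]; ring
        · obtain rfl : k = n + 1 := by omega
          rw [ht, ht, hh, hB, hΓ]; ring
    linear_combination -hG

end IsMonicOPS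

/-! ### The operators of the lattice -/

/-- The polynomial `φ Dₓ f + ψ Sₓ f`, so that `Dₓ(φ u) = Sₓ(ψ u)` says that `u` vanishes on all
polynomials of this form. -/
noncomputable def QuadLattice.pearsonOp (x : QuadLattice) (φ ψ f : ℂ[X]) : ℂ[X] :=
  φ * x.D f + ψ * x.S f

namespace QuadLattice

variable (x : QuadLattice)

theorem S_mul (f g : ℂ[X]) : x.S (f * g) = x.S f * x.S g + x.U₂ * x.D f * x.D g := by
  change (x.shift (f * g)).re = (x.shift f).re * (x.shift g).re
    + x.U₂ * (x.shift f).im * (x.shift g).im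
  rw [map_mul, QuadraticAlgebra.re_mul]

theorem D_mul (f g : ℂ[X]) : x.D (f * g) = x.D f * x.S g + x.S f * x.D g := by
  change (x.shift (f * g)).im = (x.shift f).im * (x.shift g).re
    + (x.shift f).re * (x.shift g).im
  rw [map_mul, QuadraticAlgebra.im_mul]; ring

@[simp]
theorem S_X : x.S X = X + C x.β := by
  change (x.shift X).re = _
  simp [shift]

@[simp]
theorem D_X : x.D X = 1 := by
  change (x.shift X).im = _
  simp [shift]

@[simp]
theorem S_C (a : ℂ) : x.S (C a) = C a := by
  change (x.shift (C a)).re = _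
  have : x.shift (C a) = algebraMap ℂ _ a := x.shift.commutes a
  rw [this, IsScalarTower.algebraMap_apply ℂ ℂ[X] (QuadraticAlgebra ℂ[X] x.U₂ 0)]
  simp

@[simp]
theorem D_C (a : ℂ) : x.D (C a) = 0 := by
  change (x.shift (C a)).im = _
  have : x.shift (C a) = algebraMap ℂ _ a := x.shift.commutes a
  rw [this, IsScalarTower.algebraMap_apply ℂ ℂ[X] (QuadraticAlgebra ℂ[X] x.U₂ 0)]
  simp

@[simp]
theorem S_one : x.S 1 = 1 := by simpa using x.S_C 1

@[simp]
theorem D_one : x.D 1 = 0 := by simpa using x.D_C 1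

theorem S_C_mul (a : ℂ) (f : ℂ[X]) : x.S (C a * f) = C a * x.S f := by
  simp [S_mul]

theorem D_C_mul (a : ℂ) (f : ℂ[X]) : x.D (C a * f) = C a * x.D f := by
  simp [D_mul]

theorem S_U₂ : x.S x.U₂ = x.U₂ + C (4 * x.β ^ 2) := by
  simp only [U₂, map_add, S_C_mul, S_X, S_C]
  simp only [map_mul, map_pow, C_ofNat]; ring

theorem D_U₂ : x.D x.U₂ = C (4 * x.β) := by
  simp only [U₂, map_add, D_C_mul, D_X, D_C, add_zero, mul_one]

/-- Write `E f = Sₓ f + w Dₓ f` with `w² = U₂`. Since `U₂(z + β + w) = (w + 2β)²`, the map `E`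
extends to the quadratic extension by `E w = w + 2β`, and `E (Sₓ g - w Dₓ g) = g`.
These are the two components of the latter identity. -/
theorem commutation (g : ℂ[X]) :
    x.S (x.S g) = x.U₂ * x.D (x.D g) + C (2 * x.β) * x.S (x.D g) + g ∧
      x.D (x.S g) = x.S (x.D g) + C (2 * x.β) * x.D (x.D g) := by
  induction g using Polynomial.induction_on with
  | C a => simp
  | add p q hp hq =>
    simp only [map_add] at *
    exact ⟨by linear_combination hp.1 + hq.1, by linear_combination hp.2 + hq.2⟩
  | monomial n a h =>
    have e : (C a * X ^ (n + 1) : ℂ[X]) = C a * X ^ n * X := by ring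
    rw [e]
    generalize C a * X ^ n = p at h
    obtain ⟨h1, h2⟩ := h
    simp only [S_mul, D_mul, map_add, S_X, D_X, S_C, D_C, mul_one, add_zero, S_U₂, D_U₂,
      h1, h2, map_mul, map_pow, C_ofNat]
    simp only [U₂, map_mul, C_ofNat]
    constructor <;> ring

/-! ### Leading coefficients -/

theorem coeff_U₂_mul (f : ℂ[X]) (n : ℕ) :
    (x.U₂ * f).coeff (n + 1) = 4 * x.β * f.coeff n + x.δ * f.coeff (n + 1) := by
  rw [U₂, add_mul, mul_assoc, coeff_add, coeff_C_mul, coeff_C_mul, coeff_X_mul]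

theorem S_X_pow_succ (n : ℕ) :
    x.S (X ^ (n + 1)) = X * x.S (X ^ n) + C x.β * x.S (X ^ n) + x.U₂ * x.D (X ^ n) := by
  rw [pow_succ, S_mul, S_X, D_X]; ring

theorem D_X_pow_succ (n : ℕ) :
    x.D (X ^ (n + 1)) = X * x.D (X ^ n) + C x.β * x.D (X ^ n) + x.S (X ^ n) := by
  rw [pow_succ, D_mul, S_X, D_X]; ring

theorem coeff_X_pow_eq_zero (m : ℕ) :
    (∀ k, m < k → (x.S (X ^ m)).coeff k = 0) ∧ (∀ k, m ≤ k → (x.D (X ^ m)).coeff k = 0) := by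
  induction m with
  | zero =>
    simp only [pow_zero, S_one, D_one, coeff_zero, implies_true, and_true]
    intro k hk
    rw [coeff_one, if_neg (by omega)]
  | succ m ih =>
    obtain ⟨h1, h2⟩ := ih
    constructor
    · intro k hk
      obtain ⟨k, rfl⟩ : ∃ j, k = j + 1 := ⟨k - 1, by omega⟩
      rw [S_X_pow_succ, coeff_add, coeff_add, coeff_X_mul, coeff_C_mul, coeff_U₂_mul,
        h1 _ (by omega), h1 _ (by omega), h2 _ (by omega), h2 _ (by omega)]
      ring
    · intro k hk
      obtain ⟨k, rfl⟩ : ∃ j, k = j + 1 := ⟨k - 1, by omega⟩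
      rw [D_X_pow_succ, coeff_add, coeff_add, coeff_X_mul, coeff_C_mul,
        h1 _ (by omega), h2 _ (by omega), h2 _ (by omega)]
      ring

theorem coeff_X_pow_lead (m : ℕ) :
    (x.S (X ^ m)).coeff m = 1 ∧ (x.D (X ^ (m + 1))).coeff m = m + 1 := by
  induction m with
  | zero => simp
  | succ m ih =>
    obtain ⟨h1, h2⟩ := ih
    have h3 : (x.S (X ^ (m + 1))).coeff (m + 1) = 1 := by
      rw [S_X_pow_succ, coeff_add, coeff_add, coeff_X_mul, coeff_C_mul, coeff_U₂_mul,
        (x.coeff_X_pow_eq_zero m).1 (m + 1) (by omega),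
        (x.coeff_X_pow_eq_zero m).2 m (by omega),
        (x.coeff_X_pow_eq_zero m).2 (m + 1) (by omega), h1]
      ring
    refine ⟨h3, ?_⟩
    rw [D_X_pow_succ, coeff_add, coeff_add, coeff_X_mul, coeff_C_mul, h2, h3,
      (x.coeff_X_pow_eq_zero (m + 1)).2 _ le_rfl]
    push_cast; ring

theorem coeff_X_pow_second (m : ℕ) :
    (x.S (X ^ (m + 1))).coeff m = x.β * (m + 1) * (2 * m + 1) ∧
      (x.D (X ^ (m + 2))).coeff m = x.β * (m + 2) * (m + 1) * (2 * m + 3) / 3 := by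
  induction m with
  | zero =>
    constructor
    · simp
    · rw [D_X_pow_succ]
      simp; ring
  | succ m ih =>
    obtain ⟨h1, h2⟩ := ih
    have h3 : (x.S (X ^ (m + 2))).coeff (m + 1) = x.β * (m + 2) * (2 * m + 3) := by
      rw [S_X_pow_succ, coeff_add, coeff_add, coeff_X_mul, coeff_C_mul, coeff_U₂_mul, h1,
        (x.coeff_X_pow_lead _).1, (x.coeff_X_pow_lead _).2,
        (x.coeff_X_pow_eq_zero (m + 1)).2 _ le_rfl]
      ring
    constructor
    · rw [h3]; push_cast; ring
    · rw [D_X_pow_succ, coeff_add, coeff_add, coeff_X_mul, coeff_C_mul, h2, h3,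
        (x.coeff_X_pow_lead _).2]
      push_cast; ring

theorem degree_S_lt {n : ℕ} {f : ℂ[X]} (hf : f.degree < (n : WithBot ℕ)) :
    (x.S f).degree < (n : WithBot ℕ) := by
  rw [degree_lt_iff_coeff_zero]
  intro m hm
  rw [map_eq_sum x.S hf, finsetSum_coeff]
  refine Finset.sum_eq_zero fun i hi => ?_
  rw [Finset.mem_range] at hi
  rw [coeff_C_mul, (x.coeff_X_pow_eq_zero i).1 _ (by omega), mul_zero]

theorem degree_D_lt {n : ℕ} {f : ℂ[X]} (hf : f.degree < ((n + 1 : ℕ) : WithBot ℕ)) :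
    (x.D f).degree < (n : WithBot ℕ) := by
  rw [degree_lt_iff_coeff_zero]
  intro m hm
  rw [map_eq_sum x.D hf, finsetSum_coeff]
  refine Finset.sum_eq_zero fun i hi => ?_
  rw [Finset.mem_range] at hi
  rw [coeff_C_mul, (x.coeff_X_pow_eq_zero i).2 _ (by omega), mul_zero]

theorem coeff_S {n : ℕ} {f : ℂ[X]} (hf : f.degree < ((n + 1 : ℕ) : WithBot ℕ)) :
    (x.S f).coeff n = f.coeff n := by
  rw [map_eq_sum x.S hf, Finset.sum_range_succ, coeff_add, finsetSum_coeff, coeff_C_mul,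
    (x.coeff_X_pow_lead n).1, Finset.sum_eq_zero, zero_add, mul_one]
  intro i hi
  rw [Finset.mem_range] at hi
  rw [coeff_C_mul, (x.coeff_X_pow_eq_zero i).1 _ (by omega), mul_zero]

theorem coeff_D_second {n : ℕ} {f : ℂ[X]} (hf : f.degree < ((n + 3 : ℕ) : WithBot ℕ)) :
    (x.D f).coeff n = (n + 1) * f.coeff (n + 1)
      + x.β * (n + 2) * (n + 1) * (2 * n + 3) / 3 * f.coeff (n + 2) := by
  rw [map_eq_sum x.D hf, Finset.sum_range_succ, Finset.sum_range_succ, coeff_add, coeff_add,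
    finsetSum_coeff, coeff_C_mul, coeff_C_mul, (x.coeff_X_pow_lead n).2,
    (x.coeff_X_pow_second n).2, Finset.sum_eq_zero]
  · ring
  intro i hi
  rw [Finset.mem_range] at hi
  rw [coeff_C_mul, (x.coeff_X_pow_eq_zero i).2 _ (by omega), mul_zero]

theorem coeff_D {n : ℕ} {f : ℂ[X]} (hf : f.degree < ((n + 2 : ℕ) : WithBot ℕ)) :
    (x.D f).coeff n = (n + 1) * f.coeff (n + 1) := by
  rw [x.coeff_D_second (hf.trans (by exact_mod_cast Nat.lt_succ_self _)),
    coeff_eq_zero_of_degree_lt hf, mul_zero, add_zero]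

theorem degree_D_eq {n : ℕ} {f : ℂ[X]} (hf : f.degree = ((n + 1 : ℕ) : WithBot ℕ)) :
    (x.D f).degree = (n : WithBot ℕ) := by
  have hlt : f.degree < ((n + 2 : ℕ) : WithBot ℕ) := by
    rw [hf]; exact_mod_cast Nat.lt_succ_self _
  refine le_antisymm (degree_lt_succ_iff.1 (x.degree_D_lt hlt)) (le_degree_of_ne_zero ?_)
  rw [x.coeff_D hlt]
  exact mul_ne_zero (by exact_mod_cast n.succ_ne_zero) (coeff_ne_zero_of_eq_degree hf)

/-- On polynomials of degree at most `n + 1` the iterate `Dₓⁿ` involves only the two highest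
coefficients. -/
theorem D_iterate {n : ℕ} {f : ℂ[X]} (hf : f.degree < ((n + 2 : ℕ) : WithBot ℕ)) :
    x.D^[n] f = C ((n + 1).factorial * f.coeff (n + 1)) * X
      + C (n.factorial * (f.coeff n + x.β * n * (n + 1) * (n + 2) / 3 * f.coeff (n + 1))) := by
  induction n generalizing f with
  | zero =>
    have : f.degree ≤ 1 := degree_lt_succ_iff.1 hf
    simpa using eq_X_add_C_of_degree_le_one this
  | succ n ih =>
    rw [Function.iterate_succ_apply, ih (x.degree_D_lt hf), x.coeff_D_second hf]
    have h1 := x.coeff_D (n := n + 1) hf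
    rw [h1, Nat.factorial_succ (n + 1), Nat.factorial_succ n]
    refine congrArg₂ _ (congrArg (fun t => C t * X) ?_) (congrArg C ?_) <;> push_cast <;> ring

/-- If `Φ E(f) = 0` with `f ≠ 0`, then `Φ = 0`: the norm `(Sₓ f)² - U₂ (Dₓ f)²` of `E(f)` has
degree `2 deg f`. -/
theorem eq_zero_of_mul_shift_eq_zero {φ ψ f : ℂ[X]} (hf : f ≠ 0)
    (h1 : x.pearsonOp φ ψ f = 0) (h2 : φ * x.S f + x.U₂ * ψ * x.D f = 0) : φ = 0 ∧ ψ = 0 := by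
  have hN : x.S f ^ 2 - x.U₂ * x.D f ^ 2 ≠ 0 := by
    intro h0
    have hlt := degree_lt_natDegree_succ f
    have hS : (x.S f).coeff f.natDegree ≠ 0 := by
      rw [x.coeff_S hlt]; exact leadingCoeff_ne_zero.2 hf
    have hS2 : ((f.natDegree : ℕ) : WithBot ℕ) ≤ (x.S f).degree := le_degree_of_ne_zero hS
    have hSne : x.S f ≠ 0 := fun h => hS (by rw [h, coeff_zero])
    have hDd := x.degree_D_lt hlt
    by_cases hD : x.D f = 0
    · rw [hD] at h0
      exact hSne (pow_eq_zero_iff two_ne_zero |>.1 (by linear_combination h0))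
    by_cases hU : x.U₂ = 0
    · rw [hU] at h0
      exact hSne (pow_eq_zero_iff two_ne_zero |>.1 (by linear_combination h0))
    have hUd : x.U₂.natDegree ≤ 1 := by rw [U₂]; compute_degree
    have e := congrArg natDegree (sub_eq_zero.1 h0)
    rw [natDegree_pow, natDegree_mul hU (pow_ne_zero 2 hD), natDegree_pow] at e
    rw [degree_eq_natDegree hD] at hDd
    rw [degree_eq_natDegree hSne] at hS2
    have hDd' : (x.D f).natDegree < f.natDegree := by exact_mod_cast hDd
    have hS2' : f.natDegree ≤ (x.S f).natDegree := by exact_mod_cast hS2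
    omega
  rw [pearsonOp] at h1
  constructor
  · refine (mul_eq_zero.1 ?_).resolve_right hN
    linear_combination x.S f * h2 - x.U₂ * x.D f * h1
  · refine (mul_eq_zero.1 ?_).resolve_right hN
    linear_combination x.S f * h1 - x.D f * h2

/-! ### The Pearson equation and its derivatives -/

theorem degree_pearsonOp_lt (p : PearsonPair) {m : ℕ} {f : ℂ[X]}
    (hf : f.degree < ((m + 1 : ℕ) : WithBot ℕ)) :
    (x.pearsonOp p.φ p.ψ f).degree < ((m + 2 : ℕ) : WithBot ℕ) ∧
      (x.pearsonOp p.φ p.ψ f).coeff (m + 1) = p.dn m * f.coeff m := by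
  have hD := x.degree_D_lt hf
  have hS := x.degree_S_lt hf
  rw [degree_lt_iff_coeff_zero] at hD hS
  have hco : ∀ k, (x.pearsonOp p.φ p.ψ f).coeff (k + 1)
      = p.a * (X * (x.D f)).coeff k + p.b * (x.D f).coeff k + p.c * (x.D f).coeff (k + 1)
        + p.d * (x.S f).coeff k + p.e * (x.S f).coeff (k + 1) := by
    intro k
    have e : x.pearsonOp p.φ p.ψ f = X * (C p.a * (X * x.D f)) + X * (C p.b * x.D f)
        + C p.c * x.D f + X * (C p.d * x.S f) + C p.e * x.S f := by
      simp only [pearsonOp, PearsonPair.φ, PearsonPair.ψ]; ring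
    rw [e]
    simp only [coeff_add, coeff_X_mul, coeff_C_mul]
  constructor
  · rw [degree_lt_iff_coeff_zero]
    intro k hk
    obtain ⟨k, rfl⟩ : ∃ j, k = j + 2 := ⟨k - 2, by omega⟩
    rw [hco, coeff_X_mul, hD _ (by omega), hD _ (by omega), hD _ (by omega), hS _ (by omega),
      hS _ (by omega)]
    ring
  · rw [hco, hD _ le_rfl, hD _ (by omega), hS _ le_rfl, x.coeff_S hf]
    have h : (X * x.D f).coeff m = m * f.coeff m := by
      cases m with
      | zero => simp
      | succ m => rw [coeff_X_mul, x.coeff_D hf]; push_cast; ring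
    rw [h, PearsonPair.dn]; push_cast; ring

/-- The equation `Dₓ(φ u) = Sₓ(ψ u)`, tested on polynomials. -/
def IsPearson (φ ψ : ℂ[X]) (u : PolyDual) : Prop := ∀ f, u (x.pearsonOp φ ψ f) = 0

theorem isPearson_iff (φ ψ : ℂ[X]) (u : PolyDual) :
    x.IsPearson φ ψ u ↔ x.dualD (leftMul φ u) = x.dualS (leftMul ψ u) := by
  rw [LinearMap.ext_iff]
  refine forall_congr' fun f => ?_
  change _ ↔ -(u (φ * x.D f)) = u (ψ * x.S f)
  rw [pearsonOp, map_add]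
  constructor <;> intro h <;> linear_combination -h

/-- The functional `u^{[1]} = Dₓ(U₂ ψ u) - Sₓ(φ u)`. -/
noncomputable def derivedDual (φ ψ : ℂ[X]) (u : PolyDual) : PolyDual :=
  x.dualD (leftMul (x.U₂ * ψ) u) - x.dualS (leftMul φ u)

theorem derivedDual_apply (φ ψ : ℂ[X]) (u : PolyDual) (f : ℂ[X]) :
    x.derivedDual φ ψ u f = -u (φ * x.S f + x.U₂ * ψ * x.D f) := by
  change -(u (x.U₂ * ψ * x.D f)) - u (φ * x.S f) = _
  rw [map_add]; ring

namespace IsPearson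

variable {x} {φ ψ : ℂ[X]} {u : PolyDual}

/-- The equation `Dₓ(f u^{[1]}) = -(φ Dₓ f + ψ Sₓ f) u`, tested on `g`. With `Φ = φ + ψ w` and
`E` as in `commutation`, `g Φ E(f) = Φ E(f Sₓ g) - (w + 2β) Φ E(f Dₓ g)`, and `u` annihilates the
`w`-components of `Φ E(f Sₓ g)` and `Φ E(f Dₓ g)`. -/
theorem derivedDual_D_mul (h : x.IsPearson φ ψ u) (f g : ℂ[X]) :
    x.derivedDual φ ψ u (x.D g * f) = u (g * x.pearsonOp φ ψ f) := by
  have h1 := h (f * x.S g)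
  have h2 := h (f * x.D g)
  have e : x.pearsonOp φ ψ (f * x.S g) - C (2 * x.β) * x.pearsonOp φ ψ (f * x.D g)
      = (φ * x.S (x.D g * f) + x.U₂ * ψ * x.D (x.D g * f)) + g * x.pearsonOp φ ψ f := by
    simp only [pearsonOp, S_mul, D_mul, (x.commutation g).1, (x.commutation g).2]
    ring
  have h3 := congrArg u e
  rw [map_sub, apply_C_mul, h1, h2, map_add] at h3
  rw [derivedDual_apply]
  linear_combination h3

/-- The functional `u^{[1]}` satisfies a Pearson equation again: `φ^{[1]} + ψ^{[1]} w = E(Φ)`. -/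
theorem derived (h : x.IsPearson φ ψ u) :
    x.IsPearson (x.S φ + x.U₁ * x.S ψ + x.U₂ * x.D ψ) (x.D φ + x.S ψ + x.U₁ * x.D ψ)
      (x.derivedDual φ ψ u) := by
  intro f
  have h1 := h (x.S (φ * f) + C (2 * x.β) * x.S (ψ * f) + x.U₂ * x.D (ψ * f))
  have h2 := h (x.D (φ * f) + x.S (ψ * f) + C (2 * x.β) * x.D (ψ * f))
  have e0 : x.pearsonOp (x.S φ + x.U₁ * x.S ψ + x.U₂ * x.D ψ) (x.D φ + x.S ψ + x.U₁ * x.D ψ) f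
      = x.D (φ * f) + x.S (ψ * f) + C (2 * x.β) * x.D (ψ * f) := by
    simp only [pearsonOp, S_mul, D_mul, U₁]; ring
  rw [e0, derivedDual_apply]
  generalize hr : x.S (φ * f) + C (2 * x.β) * x.S (ψ * f) + x.U₂ * x.D (ψ * f) = r at h1
  generalize hs : x.D (φ * f) + x.S (ψ * f) + C (2 * x.β) * x.D (ψ * f) = s at h2
  have e : x.pearsonOp φ ψ r - C (2 * x.β) * x.pearsonOp φ ψ s
      = φ * x.S s + x.U₂ * ψ * x.D s := by
    subst hr hs
    simp only [pearsonOp, map_add, S_C_mul, D_C_mul, S_mul x x.U₂, D_mul x x.U₂, S_U₂, D_U₂,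
      (x.commutation (φ * f)).1, (x.commutation (φ * f)).2,
      (x.commutation (ψ * f)).1, (x.commutation (ψ * f)).2]
    simp only [map_mul, map_pow, C_ofNat]
    ring
  have h3 := congrArg u e
  rw [map_sub, apply_C_mul, h1, h2] at h3
  linear_combination h3

end IsPearson

end QuadLattice

namespace QuadLattice

variable {x : QuadLattice} {u : PolyDual}

/-! ### Moments of a functional satisfying a Pearson equation -/

namespace IsPearson

variable {p : PearsonPair}

/-- If all `dₘ ≠ 0`, then the equation determines all moments of `u` from `⟨u, 1⟩`. -/
theorem apply_one_ne_zero (h : x.IsPearson p.φ p.ψ u) (hu : u ≠ 0)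
    (hd : ∀ n : ℕ, p.dn n ≠ 0) : u 1 ≠ 0 := by
  intro h0
  refine hu (LinearMap.ext fun f => ?_)
  refine dual_eq_zero_of_degree_lt (P := fun k => X ^ k) (fun k => degree_X_pow k) u
    (f.natDegree + 1) (fun k _ => ?_) f (degree_lt_natDegree_succ f)
  induction k using Nat.strong_induction_on with
  | _ k ih =>
    cases k with
    | zero => simpa using h0
    | succ m =>
      have hX : (X ^ m : ℂ[X]).degree < ((m + 1 : ℕ) : WithBot ℕ) := by
        rw [degree_X_pow]; exact_mod_cast Nat.lt_succ_self m
      obtain ⟨h1, h2⟩ := x.degree_pearsonOp_lt p hX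
      rw [coeff_X_pow_self, mul_one] at h2
      have h3 := degree_sub_C_mul_lt h1 (degree_X_pow (R := ℂ) (m + 1))
      rw [coeff_X_pow_self, div_one, h2] at h3
      have h4 := dual_eq_zero_of_degree_lt (P := fun k => X ^ k) (fun k => degree_X_pow k) u
        (m + 1) (fun j hj => ih j hj (by omega)) _ h3
      rw [map_sub, h, apply_C_mul, zero_sub, neg_eq_zero] at h4
      exact (mul_eq_zero.1 h4).resolve_left (hd m)

theorem apply_X (h : x.IsPearson p.φ p.ψ u) (h0 : p.d ≠ 0) : u X = -(p.e / p.d) * u 1 := by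
  have h1 := h 1
  have e : x.pearsonOp p.φ p.ψ 1 = C p.d * X + C p.e * 1 := by
    simp [pearsonOp, PearsonPair.ψ]
  rw [e, map_add, apply_C_mul, apply_C_mul] at h1
  field_simp
  linear_combination h1

/-- The value `⟨u^{[1]}, 1⟩ = -⟨u, φ⟩`, from the first two moment equations. -/
theorem derivedDual_apply_one (h : x.IsPearson p.φ p.ψ u) (h0 : p.d ≠ 0)
    (h1 : p.a + p.d ≠ 0) :
    x.derivedDual p.φ p.ψ u 1
      = -(p.d / (p.a + p.d) * p.φ.eval (-(p.e / p.d))) * u 1 := by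
  have hX := h.apply_X h0
  have e1 := h 1
  have e2 := h X
  have f1 : x.pearsonOp p.φ p.ψ 1 = C p.d * X + C p.e * 1 := by
    simp [pearsonOp, PearsonPair.ψ]
  have f2 : x.pearsonOp p.φ p.ψ X = C (p.a + p.d) * X ^ 2 + C (p.b + p.e) * X + C p.c * 1
      + C x.β * (C p.d * X + C p.e * 1) := by
    simp only [pearsonOp, PearsonPair.ψ, PearsonPair.φ, D_X, S_X, C_add]; ring
  have f3 : p.φ * x.S 1 + x.U₂ * p.ψ * x.D 1 = C p.a * X ^ 2 + C p.b * X + C p.c * 1 := by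
    simp [PearsonPair.φ]
  rw [f1] at e1
  rw [f2, map_add, apply_C_mul u x.β, e1] at e2
  simp only [map_add u, apply_C_mul] at e2
  rw [derivedDual_apply, f3]
  simp only [map_add u, apply_C_mul, PearsonPair.φ, eval_add, eval_mul, eval_C, eval_pow, eval_X]
  have e3 : u (X ^ 2) = -((p.b + p.e) * u X + p.c * u 1) / (p.a + p.d) := by
    field_simp; linear_combination e2
  rw [e3, hX]
  field_simp
  ring

/-! ### Regularity and the derived functional -/

theorem derivedDual_D_mul_ops {P : ℕ → ℂ[X]} (h : x.IsPearson p.φ p.ψ u) (hP : IsOPS u P)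
    (n : ℕ) {f : ℂ[X]} (hf : f.degree < ((n + 1 : ℕ) : WithBot ℕ)) :
    x.derivedDual p.φ p.ψ u (x.D (P (n + 1)) * f)
      = p.dn n * f.coeff n * (u (P (n + 1) * P (n + 1)) / (P (n + 1)).coeff (n + 1)) := by
  obtain ⟨h1, h2⟩ := x.degree_pearsonOp_lt p hf
  rw [h.derivedDual_D_mul, hP.apply_mul h1, h2]

/-- The polynomials `Dₓ Pₙ₊₁` are orthogonal with respect to `u^{[1]}`: move `Dₓ` to the other
factor and use that `φ Dₓ f + ψ Sₓ f` has degree one more than `f` when `dₙ ≠ 0`. -/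
theorem isOPS_derivedDual {P : ℕ → ℂ[X]} (h : x.IsPearson p.φ p.ψ u) (hP : IsOPS u P)
    (hd : ∀ n : ℕ, p.dn n ≠ 0) :
    IsOPS (x.derivedDual p.φ p.ψ u) (fun n => x.D (P (n + 1))) := by
  have hdeg : ∀ n, (x.D (P (n + 1))).degree = (n : WithBot ℕ) := fun n =>
    x.degree_D_eq (hP.degree_eq (n + 1))
  have hlt : ∀ n k, k < n → x.derivedDual p.φ p.ψ u (x.D (P (n + 1)) * x.D (P (k + 1))) = 0 := by
    intro n k hk
    rw [h.derivedDual_D_mul_ops hP n (by rw [hdeg]; exact_mod_cast Nat.lt_succ_of_lt hk),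
      coeff_eq_zero_of_degree_lt (by rw [hdeg]; exact_mod_cast hk), mul_zero, zero_mul]
  refine ⟨hdeg, fun n k hnk => ?_, fun n => ?_⟩
  · rcases lt_or_gt_of_ne hnk with hh | hh
    · rw [mul_comm]; exact hlt k n hh
    · exact hlt n k hh
  · rw [h.derivedDual_D_mul_ops hP n (by rw [hdeg]; exact_mod_cast Nat.lt_succ_self n)]
    exact mul_ne_zero (mul_ne_zero (hd n) (coeff_ne_zero_of_eq_degree (hdeg n)))
      (div_ne_zero (hP.sq_ne_zero _) (hP.coeff_ne_zero _))

/-- If `dₙ = 0`, then `Dₓ Pₙ₊₁` annihilates `u^{[1]}`; applying `Dₓ` to multiples of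
`Dₓ Pₙ₊₁ u^{[1]} = 0` gives `Φ E(Dₓ Pₙ₊₁) = 0`, whence `φ = ψ = 0`. -/
theorem dn_ne_zero {P : ℕ → ℂ[X]} (h : x.IsPearson p.φ p.ψ u) (hP : IsOPS u P)
    (hp : (p.φ, p.ψ) ≠ (0, 0)) (n : ℕ) : p.dn n ≠ 0 := by
  intro hn
  have hdeg : ∀ n, (x.D (P (n + 1))).degree = (n : WithBot ℕ) := fun n =>
    x.degree_D_eq (hP.degree_eq (n + 1))
  have hL : leftMul (x.D (P (n + 1))) (x.derivedDual p.φ p.ψ u) = 0 := by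
    refine dual_eq_zero hdeg _ fun m => ?_
    rw [leftMul_apply]
    rcases le_or_gt m n with hm | hm
    · rw [h.derivedDual_D_mul_ops hP n (by rw [hdeg]; exact_mod_cast Nat.lt_succ_of_le hm), hn,
        zero_mul, zero_mul]
    · rw [mul_comm,
        h.derivedDual_D_mul_ops hP m (by rw [hdeg]; exact_mod_cast Nat.lt_succ_of_lt hm),
        coeff_eq_zero_of_degree_lt (by rw [hdeg]; exact_mod_cast hm), mul_zero, zero_mul]
  generalize hQ : x.D (P (n + 1)) = Q at hL
  have hQ0 : Q ≠ 0 := by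
    rintro rfl
    have := hdeg n
    rw [hQ, degree_zero] at this
    exact absurd this (by simp)
  have key : ∀ f, x.pearsonOp p.φ p.ψ (Q * f) = 0 := fun f => by
    refine hP.eq_zero_of_apply_mul (degree_lt_natDegree_succ _) fun k _ => ?_
    rw [mul_comm, ← h.derivedDual_D_mul, mul_comm, mul_assoc]
    exact LinearMap.congr_fun hL _
  have k1 := key 1
  have k2 := key X
  rw [mul_one] at k1
  obtain ⟨e1, e2⟩ := x.eq_zero_of_mul_shift_eq_zero hQ0 k1 (by
    simp only [pearsonOp, S_mul, D_mul, S_X, D_X] at k1 k2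
    linear_combination k2 - (X + C x.β) * k1)
  exact hp (by rw [e1, e2])

end IsPearson

/-! ### The sequences `φ^{[n]}`, `ψ^{[n]}`, `u^{[n]}` -/

section Levels

variable (x) (p : PearsonPair)

/-- The coefficients of `φ^{[n]}` and of `ψ^{[n]}(z) = d_{2n} (z + β n²) + e_n`. -/
noncomputable def levelPair (n : ℕ) : PearsonPair where
  a := p.a
  b := p.b + 6 * x.β * n * p.dn n
  c := p.φ.eval (x.β * n ^ 2) + 2 * x.β * n * p.ψ.eval (x.β * n ^ 2)
            - n / 4 * (16 * x.β * x.c₆ - x.c₅ ^ 2) * p.dn n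
  d := p.dn (2 * n)
  e := p.dn (2 * n) * (x.β * n ^ 2) + x.en p n

theorem pairSeq_eq (n : ℕ) :
    x.pairSeq p.φ p.ψ n = ((x.levelPair p n).φ, (x.levelPair p n).ψ) := by
  induction n with
  | zero =>
    simp [pairSeq, levelPair, PearsonPair.φ, PearsonPair.ψ, PearsonPair.dn, en]
  | succ n ih =>
    have hδ : x.δ = x.c₅ ^ 2 / 4 - 4 * x.β * x.c₆ := by rw [δ, β]; ring
    have hφ : (x.levelPair p (n + 1)).φ = x.S (x.levelPair p n).φ
        + x.U₁ * x.S (x.levelPair p n).ψ + x.U₂ * x.D (x.levelPair p n).ψ := by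
      have e1 : (x.levelPair p (n + 1)).b = 6 * x.β * p.a + (x.levelPair p n).b
          + 6 * x.β * (x.levelPair p n).d := by
        simp only [levelPair, PearsonPair.dn]; push_cast; ring
      have e2 : (x.levelPair p (n + 1)).c = p.a * (x.β ^ 2 + x.δ) + (x.levelPair p n).b * x.β
          + (x.levelPair p n).c + 2 * x.β * ((x.levelPair p n).d * x.β + (x.levelPair p n).e)
          + x.δ * (x.levelPair p n).d := by
        simp only [levelPair, PearsonPair.dn, en, hδ, PearsonPair.φ, PearsonPair.ψ, eval_add,
          eval_mul, eval_C, eval_pow, eval_X]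
        push_cast; ring
      have e3 : ∀ m, (x.levelPair p m).a = p.a := fun _ => rfl
      simp only [PearsonPair.φ, PearsonPair.ψ, e1, e2, e3, map_add, S_X, D_X,
        S_C, D_C, pow_two, S_mul, D_mul, U₁, U₂]
      simp only [map_mul, map_add, C_ofNat]
      ring
    have hψ : (x.levelPair p (n + 1)).ψ = x.D (x.levelPair p n).φ
        + x.S (x.levelPair p n).ψ + x.U₁ * x.D (x.levelPair p n).ψ := by
      have e1 : (x.levelPair p (n + 1)).d = 2 * p.a + (x.levelPair p n).d := by
        simp only [levelPair, PearsonPair.dn]; push_cast; ring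
      have e2 : (x.levelPair p (n + 1)).e = 2 * p.a * x.β + (x.levelPair p n).b
          + 3 * x.β * (x.levelPair p n).d + (x.levelPair p n).e := by
        simp only [levelPair, PearsonPair.dn, en]; push_cast; ring
      have e3 : ∀ m, (x.levelPair p m).a = p.a := fun _ => rfl
      simp only [PearsonPair.φ, PearsonPair.ψ, e1, e2, e3, map_add, S_X, D_X,
        S_C, D_C, pow_two, S_mul, D_mul, U₁]
      simp only [map_mul, C_ofNat]
      ring
    rw [pairSeq, ih, hφ, hψ]

theorem phiSeq_eq (n : ℕ) : x.phiSeq p.φ p.ψ n = (x.levelPair p n).φ := by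
  rw [phiSeq, pairSeq_eq]

theorem psiSeq_eq (n : ℕ) : x.psiSeq p.φ p.ψ n = (x.levelPair p n).ψ := by
  rw [psiSeq, pairSeq_eq]

theorem levelPair_dn (n : ℕ) (m : ℤ) : (x.levelPair p n).dn m = p.dn (2 * n + m) := by
  simp only [PearsonPair.dn, levelPair]; push_cast; ring

/-- The number at which `φ^{[n]}` is evaluated is the zero of `ψ^{[n]}`. -/
theorem phiAt_eq {n : ℕ} (h : p.dn (2 * n) ≠ 0) :
    x.phiAt p n
      = (x.levelPair p n).φ.eval (-((x.levelPair p n).e / (x.levelPair p n).d)) := by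
  rw [phiAt, phiSeq_eq]
  congr 1
  simp only [levelPair]
  field_simp
  ring

theorem uSeq_succ (u : PolyDual) (n : ℕ) :
    x.uSeq p.φ p.ψ u (n + 1)
      = x.derivedDual (x.levelPair p n).φ (x.levelPair p n).ψ (x.uSeq p.φ p.ψ u n) := by
  rw [uSeq, phiSeq_eq, psiSeq_eq, derivedDual]

variable {x p}

theorem isPearson_uSeq (h : x.IsPearson p.φ p.ψ u) (n : ℕ) :
    x.IsPearson (x.levelPair p n).φ (x.levelPair p n).ψ (x.uSeq p.φ p.ψ u n) := by
  induction n with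
  | zero =>
    rw [← phiSeq_eq, ← psiSeq_eq]
    exact h
  | succ n ih =>
    have hd := ih.derived
    rw [← uSeq_succ, ← phiSeq_eq, ← psiSeq_eq] at hd
    rw [← phiSeq_eq, ← psiSeq_eq]
    exact hd

theorem dn_two_mul_ne_zero (hd : ∀ n : ℕ, p.dn n ≠ 0) (n : ℕ) : p.dn (2 * n) ≠ 0 := by
  exact_mod_cast hd (2 * n)

theorem levelPair_dn_ne_zero (hd : ∀ n : ℕ, p.dn n ≠ 0) (n m : ℕ) :
    (x.levelPair p n).dn m ≠ 0 := by
  rw [levelPair_dn]; exact_mod_cast hd (2 * n + m)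

theorem uSeq_succ_one (h : x.IsPearson p.φ p.ψ u) (hd : ∀ n : ℕ, p.dn n ≠ 0) (n : ℕ) :
    x.uSeq p.φ p.ψ u (n + 1) 1
      = -(p.dn (2 * n) / p.dn (2 * n + 1) * x.phiAt p n) * x.uSeq p.φ p.ψ u n 1 := by
  have e : (x.levelPair p n).a + (x.levelPair p n).d = p.dn (2 * n + 1) := by
    simp only [levelPair, PearsonPair.dn]; push_cast; ring
  have h1 : p.dn (2 * n + 1) ≠ 0 := by exact_mod_cast hd (2 * n + 1)
  rw [uSeq_succ, (isPearson_uSeq h n).derivedDual_apply_one (dn_two_mul_ne_zero hd n)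
    (by rwa [e]), e, x.phiAt_eq p (dn_two_mul_ne_zero hd n)]
  rfl

theorem uSeq_X (h : x.IsPearson p.φ p.ψ u) (hd : ∀ n : ℕ, p.dn n ≠ 0) (n : ℕ) :
    x.uSeq p.φ p.ψ u n X
      = (-x.β * n ^ 2 - x.en p n / p.dn (2 * n)) * x.uSeq p.φ p.ψ u n 1 := by
  have h0 := dn_two_mul_ne_zero hd n
  rw [(isPearson_uSeq h n).apply_X h0]
  simp only [levelPair]
  field_simp
  ring

theorem uSeq_one_ne_zero (h : x.IsPearson p.φ p.ψ u) (hu : u ≠ 0)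
    (hd : ∀ n : ℕ, p.dn n ≠ 0) (hφ : ∀ n, x.phiAt p n ≠ 0) (n : ℕ) :
    x.uSeq p.φ p.ψ u n 1 ≠ 0 := by
  induction n with
  | zero => exact h.apply_one_ne_zero hu hd
  | succ n ih =>
    rw [uSeq_succ_one h hd]
    have h1 : p.dn (2 * n + 1) ≠ 0 := by exact_mod_cast hd (2 * n + 1)
    exact mul_ne_zero (neg_ne_zero.2 (mul_ne_zero
      (div_ne_zero (dn_two_mul_ne_zero hd n) h1) (hφ n))) ih

/-- Necessity of the regularity conditions: every `u^{[n]}` is regular, so `⟨u^{[n]}, 1⟩ ≠ 0`. -/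
theorem conditions_of_isRegular (h : x.IsPearson p.φ p.ψ u) (hp : (p.φ, p.ψ) ≠ (0, 0))
    (hu : IsRegularFunctional u) (n : ℕ) : p.dn n ≠ 0 ∧ x.phiAt p n ≠ 0 := by
  have hd : ∀ n : ℕ, p.dn n ≠ 0 := by
    obtain ⟨P, hP⟩ := hu
    exact h.dn_ne_zero hP hp
  have hreg : ∀ n, IsRegularFunctional (x.uSeq p.φ p.ψ u n) := by
    intro n
    induction n with
    | zero => exact hu
    | succ n ih =>
      obtain ⟨P, hP⟩ := ih
      rw [uSeq_succ]
      exact ⟨_, (isPearson_uSeq h n).isOPS_derivedDual hP (levelPair_dn_ne_zero hd n)⟩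
  refine ⟨hd n, fun h0 => ?_⟩
  obtain ⟨P, hP⟩ := hreg (n + 1)
  refine hP.apply_one_ne_zero ?_
  rw [uSeq_succ_one h hd, h0]; ring

/-! ### The Rodrigues formula -/

theorem dualD_leftMul_derivedDual {φ ψ : ℂ[X]} (h : x.IsPearson φ ψ u) (f : ℂ[X]) :
    x.dualD (leftMul f (x.derivedDual φ ψ u)) = leftMul (-x.pearsonOp φ ψ f) u := by
  refine LinearMap.ext fun g => ?_
  change -(x.derivedDual φ ψ u (f * x.D g)) = u (-x.pearsonOp φ ψ f * g)
  rw [mul_comm f, h.derivedDual_D_mul, neg_mul, map_neg, mul_comm g]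

/-- The functional `Dₓⁿ (g u^{[n]})` is a polynomial multiple of `u`. Each application of `Dₓ`
lowers the level by one and raises the degree by one; the indices of the factors `d` collected on
the way from level `n` with `deg g ≤ m` run down from `m + 2n - 2` to `m + n - 1`. -/
theorem exists_iterate_dualD (h : x.IsPearson p.φ p.ψ u) (n m : ℕ) {g : ℂ[X]}
    (hg : g.degree < ((m + 1 : ℕ) : WithBot ℕ)) :
    ∃ R : ℂ[X], R.degree < ((m + n + 1 : ℕ) : WithBot ℕ) ∧
      R.coeff (m + n) = (-1) ^ n * (∏ i ∈ Finset.range n, p.dn (m + n - 1 + i)) * g.coeff m ∧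
      x.dualD^[n] (leftMul g (x.uSeq p.φ p.ψ u n)) = leftMul R u := by
  induction n generalizing m g with
  | zero => exact ⟨g, hg, by simp, rfl⟩
  | succ n ih =>
    obtain ⟨h1, h2⟩ := x.degree_pearsonOp_lt (x.levelPair p n) hg
    rw [← degree_neg] at h1
    obtain ⟨R, hR1, hR2, hR3⟩ := ih (m + 1) h1
    refine ⟨R, by convert hR1 using 2; push_cast; ring, ?_, ?_⟩
    · rw [show m + (n + 1) = m + 1 + n by ring, hR2, coeff_neg, h2, levelPair_dn,
        Finset.prod_range_succ]
      have e1 : ∀ i : ℕ, p.dn ((m : ℤ) + (n + 1 : ℕ) - 1 + i)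
          = p.dn (((m + 1 : ℕ) : ℤ) + n - 1 + i) := fun i => by
        congr 1; push_cast; ring
      have e2 : p.dn (2 * n + m : ℤ) = p.dn (((m + 1 : ℕ) : ℤ) + n - 1 + n) := by
        congr 1; push_cast; ring
      simp only [e1, e2]
      ring
    · rw [Function.iterate_succ_apply, uSeq_succ, dualD_leftMul_derivedDual (isPearson_uSeq h n)]
      exact hR3

theorem iterate_dualD_apply (v : PolyDual) (n : ℕ) (f : ℂ[X]) :
    (x.dualD^[n] v) f = (-1) ^ n * v (x.D^[n] f) := by
  induction n generalizing f with
  | zero => simp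
  | succ n ih =>
    rw [Function.iterate_succ_apply', Function.iterate_succ_apply]
    change -((x.dualD^[n] v) (x.D f)) = _
    rw [ih]; ring

theorem rodriguesConst_eq (n : ℕ) :
    p.rodriguesConst n = (-1) ^ n * (∏ i ∈ Finset.range n, p.dn (n - 1 + i))⁻¹ := by
  rw [PearsonPair.rodriguesConst, prod_Icc_one_eq (fun j => (p.dn (n + j - 2))⁻¹),
    Finset.prod_inv_distrib]
  congr 2
  refine Finset.prod_congr rfl fun i _ => ?_
  congr 1; push_cast; ring

theorem prod_dn_ne_zero (hd : ∀ n : ℕ, p.dn n ≠ 0) (n : ℕ) :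
    ∏ i ∈ Finset.range n, p.dn (n - 1 + i) ≠ 0 := by
  refine Finset.prod_ne_zero_iff.2 fun i hi => ?_
  rw [Finset.mem_range] at hi
  have e : (n : ℤ) - 1 + i = ((n - 1 + i : ℕ) : ℤ) := by omega
  rw [e]; exact hd _

theorem rodriguesConst_succ (hd : ∀ n : ℕ, p.dn n ≠ 0) (n : ℕ) :
    p.rodriguesConst (n + 1) = -(p.dRatio n / p.dn (2 * n)) * p.rodriguesConst n := by
  have h2 := dn_two_mul_ne_zero hd n
  have key : p.dRatio n * ∏ i ∈ Finset.range (n + 1), p.dn ((n + 1 : ℕ) - 1 + i)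
      = p.dn (2 * n) * ∏ i ∈ Finset.range n, p.dn (n - 1 + i) := by
    have e2 : p.dn (((n + 1 : ℕ) : ℤ) - 1 + n) = p.dn (2 * n) := by
      congr 1; push_cast; ring
    rw [Finset.prod_range_succ, e2]
    cases n with
    | zero => simp [PearsonPair.dRatio]
    | succ m =>
      have h1 : p.dn (2 * (m + 1 : ℕ) - 1) ≠ 0 := by
        have := hd (2 * m + 1)
        convert this using 2; push_cast; ring
      have e3 : ∏ i ∈ Finset.range m, p.dn (((m + 1 + 1 : ℕ) : ℤ) - 1 + i)
          = ∏ i ∈ Finset.range m, p.dn (((m + 1 : ℕ) : ℤ) - 1 + (i + 1 : ℕ)) :=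
        Finset.prod_congr rfl fun i _ => by congr 1; push_cast; ring
      have e4 : p.dn (((m + 1 + 1 : ℕ) : ℤ) - 1 + m) = p.dn (2 * (m + 1 : ℕ) - 1) := by
        congr 1; push_cast; ring
      rw [Finset.prod_range_succ, Finset.prod_range_succ', e3, e4, PearsonPair.dRatio,
        if_neg (Nat.succ_ne_zero m)]
      push_cast at h1 ⊢
      field_simp
      simp only [add_zero, add_sub_cancel_right]
      ring
  have hA := prod_dn_ne_zero hd n
  have hB := prod_dn_ne_zero hd (n + 1)
  rw [rodriguesConst_eq, rodriguesConst_eq]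
  field_simp
  rw [pow_succ]
  linear_combination (-1) ^ n * key

theorem rodriguesConst_ne_zero (hd : ∀ n : ℕ, p.dn n ≠ 0) (n : ℕ) : p.rodriguesConst n ≠ 0 := by
  rw [rodriguesConst_eq]
  exact mul_ne_zero (pow_ne_zero _ (by norm_num)) (inv_ne_zero (prod_dn_ne_zero hd n))

/-- Sufficiency of the conditions. The right-hand side of the Rodrigues formula is a polynomial
multiple `Pₙ u` of `u`; pairing it with powers of `z` moves `Dₓⁿ` to the other side, which gives
orthogonality and the numbers `⟨u, Pₙ zⁿ⟩`, `⟨u, Pₙ zⁿ⁺¹⟩` from which the recurrence follows. -/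
theorem exists_isMonicOPS (h : x.IsPearson p.φ p.ψ u) (hu : u ≠ 0)
    (hd : ∀ n : ℕ, p.dn n ≠ 0) (hφ : ∀ n, x.phiAt p n ≠ 0) :
    ∃ P : ℕ → ℂ[X], IsMonicOPS u P ∧ SatisfiesTTRR P (x.recB p) (x.recCsucc p) ∧
      ∀ n : ℕ, leftMul (P n) u = p.rodriguesConst n • x.dualD^[n] (x.uSeq p.φ p.ψ u n) := by
  have hex : ∀ n, ∃ P : ℂ[X], P.degree < ((n + 1 : ℕ) : WithBot ℕ) ∧ P.coeff n = 1 ∧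
      leftMul P u = p.rodriguesConst n • x.dualD^[n] (x.uSeq p.φ p.ψ u n) := by
    intro n
    obtain ⟨R, hR1, hR2, hR3⟩ := exists_iterate_dualD h n 0 (g := 1)
      (by rw [degree_one]; exact_mod_cast Nat.zero_lt_one)
    have e1 : leftMul 1 (x.uSeq p.φ p.ψ u n) = x.uSeq p.φ p.ψ u n :=
      LinearMap.ext fun f => by rw [leftMul_apply, one_mul]
    rw [e1] at hR3
    rw [zero_add] at hR1 hR2
    refine ⟨C (p.rodriguesConst n) * R, ?_, ?_, ?_⟩
    · rw [← smul_eq_C_mul]; exact lt_of_le_of_lt (degree_smul_le _ _) hR1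
    · rw [coeff_C_mul, hR2, rodriguesConst_eq, coeff_one_zero, mul_one]
      have hA := prod_dn_ne_zero hd n
      simp only [Nat.cast_zero, zero_add]
      field_simp
      rw [← pow_mul, mul_comm, pow_mul]; simp
    · rw [hR3]
      refine LinearMap.ext fun f => ?_
      rw [leftMul_apply, mul_assoc, apply_C_mul]; rfl
  choose P hP1 hP2 hP3 using hex
  have hdeg : ∀ n, (P n).degree = (n : WithBot ℕ) := fun n =>
    le_antisymm (degree_lt_succ_iff.1 (hP1 n))
      (le_degree_of_ne_zero (by rw [hP2]; exact one_ne_zero))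
  have hmon : ∀ n, (P n).Monic := fun n => by
    rw [Monic, leadingCoeff, natDegree_eq_of_degree_eq_some (hdeg n), hP2]
  have hval : ∀ n f, u (P n * f)
      = p.rodriguesConst n * ((-1) ^ n * x.uSeq p.φ p.ψ u n (x.D^[n] f)) := fun n f => by
    rw [← iterate_dualD_apply, ← leftMul_apply, hP3]; rfl
  have hsmall : ∀ n k, k ≤ n → u (P n * X ^ k) = p.rodriguesConst n * ((-1) ^ n *
      (n.factorial * (X ^ k : ℂ[X]).coeff n * x.uSeq p.φ p.ψ u n 1)) := fun n k hk => by
    have hlt : (X ^ k : ℂ[X]).degree < ((n + 2 : ℕ) : WithBot ℕ) := by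
      rw [degree_X_pow]; exact_mod_cast (by omega : k < n + 2)
    rw [hval, x.D_iterate hlt, coeff_X_pow (n := n + 1), if_neg (by omega), mul_zero, C_0,
      zero_mul, zero_add, mul_zero, add_zero, ← mul_one (C _), apply_C_mul]
  have hone := uSeq_one_ne_zero h hu hd hφ
  have hmops : IsMonicOPS u P := by
    refine isMonicOPS_of_apply_mul_X_pow hdeg hmon (fun n k hk => ?_) fun n => ?_
    · rw [hsmall n k hk.le, coeff_X_pow, if_neg (by omega)]; ring
    · rw [hsmall n n le_rfl, coeff_X_pow_self, mul_one]
      exact mul_ne_zero (rodriguesConst_ne_zero hd n) (mul_ne_zero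
        (pow_ne_zero _ (by norm_num)) (mul_ne_zero (by exact_mod_cast n.factorial_ne_zero)
          (hone n)))
  refine ⟨P, hmops, ?_, hP3⟩
  -- `(n + 1) × (zero of ψ^{[n]})` is the contribution of the linear term of `Dₓⁿ zⁿ⁺¹`, and the
  -- last summand of `t n` that of its constant term
  refine hmops.satisfiesTTRR
    (h := fun n => p.rodriguesConst n * ((-1) ^ n * (n.factorial * x.uSeq p.φ p.ψ u n 1)))
    (t := fun n => (n + 1) * (-x.β * n ^ 2 - x.en p n / p.dn (2 * n))
      + x.β * n * (n + 1) * (n + 2) / 3) ?_ ?_ ?_ ?_ ?_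
  · intro n
    rw [hsmall n n le_rfl, coeff_X_pow_self, mul_one]
  · intro n
    have hlt : (X ^ (n + 1) : ℂ[X]).degree < ((n + 2 : ℕ) : WithBot ℕ) := by
      rw [degree_X_pow]; exact_mod_cast Nat.lt_succ_self (n + 1)
    rw [hval, x.D_iterate hlt, coeff_X_pow_self, coeff_X_pow, if_neg (by omega), map_add,
      ← mul_one (C (_ * (0 + _))), apply_C_mul, apply_C_mul, uSeq_X h hd, Nat.factorial_succ]
    push_cast; ring
  · intro n
    have h2 := dn_two_mul_ne_zero hd n
    rw [rodriguesConst_succ hd, uSeq_succ_one h hd, Nat.factorial_succ, recCsucc]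
    have h1 : p.dn (2 * n + 1) ≠ 0 := by exact_mod_cast hd (2 * n + 1)
    push_cast
    field_simp
    ring
  · simp [recB]
  · intro n
    have e1 : p.dn (2 * ((n + 1 : ℕ) : ℤ) - 2) = p.dn (2 * n) := by
      congr 1; push_cast; ring
    have e2 : x.en p (((n + 1 : ℕ) : ℤ) - 1) = x.en p n := by
      congr 1; push_cast; ring
    rw [recB, e1, e2]
    push_cast
    ring

end Levels

end QuadLattice

/-! ### The constant lattice -/

namespace QuadLattice

/-- The constant lattice `x(s) = 0`, for which `Dₓ` is the derivative and `Sₓ` the identity. -/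
def const : QuadLattice := ⟨0, 0, 0⟩

theorem const_S (f : ℂ[X]) : const.S f = f := const.S_of_constant rfl rfl f

theorem const_D (f : ℂ[X]) : const.D f = derivative f := const.D_of_constant rfl rfl f

theorem const_β : const.β = 0 := by simp [β, const]

theorem const_U₂ : const.U₂ = 0 := by
  rw [U₂, const_β]; simp [δ, const]

theorem const_dualD : const.dualD = dualDeriv := by
  funext u
  refine LinearMap.ext fun f => ?_
  change -(u (const.D f)) = -(u (derivative f))
  rw [const_D]

theorem const_isPearson_iff (φ ψ : ℂ[X]) (u : PolyDual) :
    const.IsPearson φ ψ u ↔ dualDeriv (leftMul φ u) = leftMul ψ u := by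
  rw [isPearson_iff, const_dualD]
  have : const.dualS (leftMul ψ u) = leftMul ψ u := LinearMap.ext fun f => by
    change u (ψ * const.S f) = u (ψ * f)
    rw [const_S]
  rw [this]

theorem const_levelPair_φ (p : PearsonPair) (n : ℕ) : (const.levelPair p n).φ = p.φ := by
  simp only [levelPair, PearsonPair.φ, const_β]
  simp [const]

theorem const_uSeq_apply (p : PearsonPair) (u : PolyDual) (n : ℕ) (f : ℂ[X]) :
    const.uSeq p.φ p.ψ u n f = (-1) ^ n * u (p.φ ^ n * f) := by
  induction n generalizing f with
  | zero => simp [uSeq]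
  | succ n ih =>
    rw [uSeq_succ, derivedDual_apply, const_levelPair_φ, const_U₂, const_S, zero_mul, zero_mul,
      add_zero, ih, ← mul_assoc, ← pow_succ]
    ring

theorem const_en (p : PearsonPair) (n : ℤ) : const.en p n = p.en n := by
  simp [en, PearsonPair.en, const_β]

theorem const_phiAt (p : PearsonPair) (n : ℕ) :
    const.phiAt p n = p.φ.eval (-(p.en n / p.dn (2 * n))) := by
  rw [phiAt, phiSeq_eq, const_levelPair_φ, const_β, const_en]
  simp

theorem const_recB (p : PearsonPair) : const.recB p = p.recB := by
  funext n
  simp [recB, PearsonPair.recB, const_β, const_en]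

theorem const_recCsucc (p : PearsonPair) : const.recCsucc p = p.recCsucc := by
  funext n
  rw [recCsucc, PearsonPair.recCsucc, const_phiAt]

theorem const_rodrigues (p : PearsonPair) (u : PolyDual) (n : ℕ) :
    p.rodriguesConst n • const.dualD^[n] (const.uSeq p.φ p.ψ u n)
      = p.derivRodriguesConst n • dualDeriv^[n] (leftMul (p.φ ^ n) u) := by
  have hc : p.rodriguesConst n = (-1) ^ n * p.derivRodriguesConst n := by
    rw [rodriguesConst_eq, PearsonPair.derivRodriguesConst, Finset.prod_inv_distrib]
    congr 2
    refine Finset.prod_congr rfl fun i _ => ?_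
    congr 1; ring
  rw [← const_dualD]
  refine LinearMap.ext fun f => ?_
  rw [LinearMap.smul_apply, LinearMap.smul_apply, iterate_dualD_apply, iterate_dualD_apply,
    const_uSeq_apply, leftMul_apply, hc, smul_eq_mul, smul_eq_mul]
  have h1 : ((-1 : ℂ) ^ n) * (-1) ^ n = 1 := by rw [← mul_pow]; simp
  linear_combination (p.derivRodriguesConst n * (-1) ^ n * u (p.φ ^ n * const.D^[n] f)) * h1

end QuadLattice

/-- Hahn's property implies the Pearson equation. If `Qₙ = P'ₙ₊₁` is orthogonal with respect to
`v`, then `D v` and `D (Q₁ v)` vanish on all `Pₘ` except `P₁`, respectively `P₂`, so that they are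
multiples of `P₁ u` and `P₂ u`. Subtracting gives `Q₁' v = D (Q₁ v) - Q₁ D v` as a quadratic
multiple of `u`, and `Q₁'` is a nonzero constant. -/
theorem IsDClassical.exists_pearson {u : PolyDual} (hu : IsDClassical u) :
    ∃ p : PearsonPair, (p.φ, p.ψ) ≠ (0, 0) ∧ dualDeriv (leftMul p.φ u) = leftMul p.ψ u := by
  obtain ⟨P, hP, v, hv⟩ := hu
  set Q : ℕ → ℂ[X] := fun n => derivative (P (n + 1)) with hQ
  have hP0 : derivative (P 0) = 0 := by
    rw [eq_C_of_degree_eq_zero (p := P 0) (by simpa using hP.degree_eq 0), derivative_C]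
  have hQ0 : Q 0 = C ((Q 0).coeff 0) := eq_C_of_degree_eq_zero (by simpa using hv.degree_eq 0)
  have hv0 : ∀ n, n ≠ 0 → v (Q n) = 0 := fun n hn => by
    have h1 := hv.orthogonal 0 n (Ne.symm hn)
    change v (Q 0 * Q n) = 0 at h1
    rw [hQ0, apply_C_mul] at h1
    exact (mul_eq_zero.1 h1).resolve_left (hv.coeff_ne_zero 0)
  -- `D v = c₁ P₁ u` and `D (Q₁ v) = c₂ P₂ u`
  obtain ⟨c₁, hc₁0, hc₁⟩ : ∃ c : ℂ, c ≠ 0 ∧ ∀ f, v (derivative f) = -u (C c * P 1 * f) := by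
    refine ⟨-(v (Q 0) / u (P 1 * P 1)), ?_, fun f => ?_⟩
    · have h1 := hv.sq_ne_zero 0
      change v (Q 0 * Q 0) ≠ 0 at h1
      nth_rewrite 1 [hQ0] at h1
      rw [apply_C_mul] at h1
      exact neg_ne_zero.2 (div_ne_zero (right_ne_zero_of_mul h1) (hP.sq_ne_zero 1))
    · have h := dual_eq_zero hP.degree_eq
        (v ∘ₗ derivative + leftMul (C (-(v (Q 0) / u (P 1 * P 1))) * P 1) u) fun k => by
          change v (derivative (P k)) + u (C (-(v (Q 0) / u (P 1 * P 1))) * P 1 * P k) = 0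
          rw [mul_assoc, apply_C_mul]
          match k with
          | 0 => rw [hP0, map_zero, hP.orthogonal 1 0 one_ne_zero]; ring
          | 1 =>
            have h1 := hP.sq_ne_zero 1
            change v (Q 0) + _ = 0
            field_simp
            ring
          | k + 2 =>
            change v (Q (k + 1)) + _ = 0
            rw [hv0 _ (Nat.succ_ne_zero k), hP.orthogonal 1 (k + 2) (by omega)]; ring
      exact eq_neg_of_add_eq_zero_left (LinearMap.congr_fun h f)
  obtain ⟨c₂, hc₂⟩ : ∃ c : ℂ, ∀ f, v (Q 1 * derivative f) = -u (C c * P 2 * f) := by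
    refine ⟨-(v (Q 1 * Q 1) / u (P 2 * P 2)), fun f => ?_⟩
    have h := dual_eq_zero hP.degree_eq
      (leftMul (Q 1) v ∘ₗ derivative + leftMul (C (-(v (Q 1 * Q 1) / u (P 2 * P 2))) * P 2) u)
      fun k => by
        change v (Q 1 * derivative (P k))
          + u (C (-(v (Q 1 * Q 1) / u (P 2 * P 2))) * P 2 * P k) = 0
        rw [mul_assoc, apply_C_mul]
        match k with
        | 0 => rw [hP0, mul_zero, map_zero, hP.orthogonal 2 0 two_ne_zero]; ring
        | 1 =>
          have h1 : v (Q 1 * derivative (P 1)) = 0 := hv.orthogonal 1 0 one_ne_zero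
          rw [h1, hP.orthogonal 2 1 (by omega)]; ring
        | 2 =>
          have h1 := hP.sq_ne_zero 2
          change v (Q 1 * Q 1) + _ = 0
          field_simp
          ring
        | k + 3 =>
          have h1 : v (Q 1 * derivative (P (k + 3))) = 0 := hv.orthogonal 1 (k + 2) (by omega)
          rw [h1, hP.orthogonal 2 (k + 3) (by omega)]; ring
    exact eq_neg_of_add_eq_zero_left (LinearMap.congr_fun h f)
  obtain ⟨κ, hκ0, hκ⟩ : ∃ κ : ℂ, κ ≠ 0 ∧ derivative (Q 1) = C κ := by
    have hd : (Q 1).degree = ((1 : ℕ) : WithBot ℕ) := hv.degree_eq 1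
    refine ⟨(Q 1).coeff 1, hv.coeff_ne_zero 1, ?_⟩
    conv_lhs => rw [eq_X_add_C_of_degree_le_one hd.le]
    simp
  have hdeg1 : ∀ {f : ℂ[X]}, f.degree = ((1 : ℕ) : WithBot ℕ) → f.natDegree = 1 := fun h =>
    natDegree_eq_of_degree_eq_some h
  set ψ : ℂ[X] := C c₁ * P 1 with hψ
  set φ : ℂ[X] := C κ⁻¹ * (C c₂ * P 2 - C c₁ * P 1 * Q 1) with hφ
  have hφu : ∀ f, v f = u (φ * f) := fun f => by
    have h1 := hc₁ (Q 1 * f)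
    have h2 := hc₂ f
    rw [derivative_mul, hκ, map_add, apply_C_mul, h2] at h1
    have e : φ * f = C κ⁻¹ * (C c₂ * P 2 * f - C c₁ * P 1 * (Q 1 * f)) := by rw [hφ]; ring
    rw [e, apply_C_mul, map_sub]
    field_simp
    linear_combination h1
  have hψd : ψ.natDegree ≤ 1 :=
    (natDegree_C_mul_le _ _).trans (hdeg1 (hP.degree_eq 1)).le
  have hφd : φ.natDegree ≤ 2 := by
    refine (natDegree_C_mul_le _ _).trans ((natDegree_sub_le _ _).trans (max_le ?_ ?_))
    · exact (natDegree_C_mul_le _ _).trans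
        (natDegree_eq_of_degree_eq_some (hP.degree_eq 2)).le
    · exact natDegree_mul_le.trans (Nat.add_le_add hψd (hdeg1 (hv.degree_eq 1)).le)
  refine ⟨⟨φ.coeff 2, φ.coeff 1, φ.coeff 0, ψ.coeff 1, ψ.coeff 0⟩, ?_, ?_⟩
  all_goals
    have e1 : PearsonPair.φ ⟨φ.coeff 2, φ.coeff 1, φ.coeff 0, ψ.coeff 1, ψ.coeff 0⟩ = φ := by
      conv_rhs => rw [φ.as_sum_range_C_mul_X_pow' (n := 3) (by omega)]
      simp only [PearsonPair.φ, Finset.sum_range_succ, Finset.sum_range_zero]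
      ring
    have e2 : PearsonPair.ψ ⟨φ.coeff 2, φ.coeff 1, φ.coeff 0, ψ.coeff 1, ψ.coeff 0⟩ = ψ := by
      conv_rhs => rw [eq_X_add_C_of_natDegree_le_one hψd]
      rfl
    rw [e1, e2]
  · intro h0
    have h1 : C c₁ * P 1 = 0 := congrArg Prod.snd h0
    rcases mul_eq_zero.1 h1 with h2 | h2
    · exact hc₁0 (C_eq_zero.1 h2)
    · exact hP.coeff_ne_zero 1 (by rw [h2, coeff_zero])
  · refine LinearMap.ext fun f => ?_
    change -(u (φ * derivative f)) = u (ψ * f)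
    rw [← hφu, hc₁, neg_neg]

/-! ### Characterization of the regular functionals -/

theorem mainTheorem2 :
    -- the lattice `x(s) = c₄ s² + c₅ s + c₆`
    (∀ (x : QuadLattice) (u : PolyDual) (p : PearsonPair), u ≠ 0 → (p.φ, p.ψ) ≠ (0, 0) →
      x.dualD (leftMul p.φ u) = x.dualS (leftMul p.ψ u) →
      (∀ n : ℕ, x.phiSeq p.φ p.ψ n =
        C p.a * X ^ 2 + C (p.b + 6 * x.β * n * p.dn n) * X
          + C (p.φ.eval (x.β * n ^ 2) + 2 * x.β * n * p.ψ.eval (x.β * n ^ 2)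
            - n / 4 * (16 * x.β * x.c₆ - x.c₅ ^ 2) * p.dn n)) ∧
      (IsRegularFunctional u ↔ ∀ n : ℕ, p.dn n ≠ 0 ∧ x.phiAt p n ≠ 0) ∧
      ((∀ n : ℕ, p.dn n ≠ 0 ∧ x.phiAt p n ≠ 0) →
        ∃ P : ℕ → ℂ[X], IsMonicOPS u P ∧ (∀ Q : ℕ → ℂ[X], IsMonicOPS u Q → Q = P) ∧
          SatisfiesTTRR P (x.recB p) (x.recCsucc p) ∧
          ∀ n : ℕ, leftMul (P n) u =
            p.rodriguesConst n • x.dualD^[n] (x.uSeq p.φ p.ψ u n))) ∧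
    -- the constant lattice, where `Dₓ` is the ordinary derivative and `Sₓ` is the identity
    (∀ u : PolyDual, u ≠ 0 →
      (IsDClassical u ↔ ∃ p : PearsonPair, dualDeriv (leftMul p.φ u) = leftMul p.ψ u ∧
        ∀ n : ℕ, p.dn n ≠ 0 ∧ p.φ.eval (-(p.en n / p.dn (2 * n))) ≠ 0) ∧
      ∀ p : PearsonPair, dualDeriv (leftMul p.φ u) = leftMul p.ψ u →
        (∀ n : ℕ, p.dn n ≠ 0 ∧ p.φ.eval (-(p.en n / p.dn (2 * n))) ≠ 0) →
        ∃ P : ℕ → ℂ[X], IsMonicOPS u P ∧ (∀ Q : ℕ → ℂ[X], IsMonicOPS u Q → Q = P) ∧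
          SatisfiesTTRR P p.recB p.recCsucc ∧
          ∀ n : ℕ, leftMul (P n) u =
            p.derivRodriguesConst n • dualDeriv^[n] (leftMul (p.φ ^ n) u)) := by
  refine ⟨fun x u p hu hp h => ?_, fun u hu => ?_⟩
  · rw [← x.isPearson_iff] at h
    refine ⟨fun n => x.phiSeq_eq p n, ⟨fun hr => x.conditions_of_isRegular h hp hr, fun hc => ?_⟩,
      fun hc => ?_⟩
    · obtain ⟨P, hP, -⟩ := x.exists_isMonicOPS h hu (fun n => (hc n).1) fun n => (hc n).2
      exact ⟨P, hP.toIsOPS⟩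
    · obtain ⟨P, hP, hT, hR⟩ := x.exists_isMonicOPS h hu (fun n => (hc n).1) fun n => (hc n).2
      exact ⟨P, hP, fun Q hQ => hP.unique hQ, hT, hR⟩
  · have key : ∀ p : PearsonPair, dualDeriv (leftMul p.φ u) = leftMul p.ψ u →
        (∀ n : ℕ, p.dn n ≠ 0 ∧ p.φ.eval (-(p.en n / p.dn (2 * n))) ≠ 0) →
        ∃ P : ℕ → ℂ[X], IsMonicOPS u P ∧ (∀ Q : ℕ → ℂ[X], IsMonicOPS u Q → Q = P) ∧
          SatisfiesTTRR P p.recB p.recCsucc ∧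
          ∀ n : ℕ, leftMul (P n) u =
            p.derivRodriguesConst n • dualDeriv^[n] (leftMul (p.φ ^ n) u) := by
      intro p h hc
      rw [← QuadLattice.const_isPearson_iff] at h
      obtain ⟨P, hP, hT, hR⟩ := QuadLattice.exists_isMonicOPS h hu (fun n => (hc n).1) fun n => by
        rw [QuadLattice.const_phiAt]; exact (hc n).2
      rw [QuadLattice.const_recB, QuadLattice.const_recCsucc] at hT
      exact ⟨P, hP, fun Q hQ => hP.unique hQ, hT, fun n => by
        rw [hR, QuadLattice.const_rodrigues]⟩
    refine ⟨⟨fun hcl => ?_, fun ⟨p, h, hc⟩ => ?_⟩, key⟩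
    · obtain ⟨p, hp, h⟩ := hcl.exists_pearson
      refine ⟨p, h, fun n => ?_⟩
      rw [← QuadLattice.const_isPearson_iff] at h
      obtain ⟨P, hP, -⟩ := hcl
      rw [← QuadLattice.const_phiAt]
      exact QuadLattice.conditions_of_isRegular h hp ⟨P, hP⟩ n
    · obtain ⟨P, hP, -⟩ := key p h hc
      rw [← QuadLattice.const_isPearson_iff] at h
      have hQ := h.isOPS_derivedDual hP.toIsOPS fun n => (hc n).1
      simp only [QuadLattice.const_D] at hQ
      exact ⟨P, hP.toIsOPS, _, hQ⟩
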